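/- Let $\Bbbk$ be an algebraically closed field of characteristic zero, let $p$ be an odd prime, and fix $\sqrt{-1}\in\Bbbk$. Let $\mathcal H_{8p}$ be the $\Bbbk$-algebra generated by $a,x,z$ with relations $$a^2=1,\quad x^{2p}=1,\quad z^2=a-1,\quad ax=xa,\quad az=za,\quad xz=-zx.$$ Put $e_0=(1+a)/2$, $e_1=(1-a)/2$ and $g=(e_0+\sqrt{-1}\,e_1)x^p$. Then $\mathcal H_{8p}$ is a Hopf algebra with $$\Delta(a)=a\otimes a,\quad \Delta(x)=x\otimes e_0x+ax^{-1}\otimes e_1x,\quad \Delta(z)=g\otimes z+z\otimes 1,$$ $$\varepsilon(a)=\varepsilon(x)=1,\ \varepsilon(z)=0,\qquad \mathcal S(a)=a,\ \mathcal S(x)=e_0x^{-1}+ae_1x,\ \mathcal S(z)=-g^{-1}z.$$ For a coalgebra $C$ let $C_0$, its coradical, be the sum of its simple subcoalgebras. A Hopf algebra $H$ is called pointed if $H_0$ is spanned by the group-like elements, and basic if all simple $H$-modules are one-dimensional. Let $\mathrm{Dic}_p=\langle s,t\mid s^4=t^p=1,\ sts^{-1}=t^{-1}\rangle$ be the dicyclic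 group of order $4p$, $\Bbbk^{\mathrm{Dic}_p}$ the Hopf algebra of $\Bbbk$-valued functions on it, $C_{2p}$ the cyclic group of order $2p$, and $\mathcal M^*(2,\Bbbk)$ the simple coalgebra dual to the algebra of $2\times 2$ matrices over $\Bbbk$. Then: 1. $\mathcal H_{8p}$ is not semisimple, not pointed and not basic, and $\dim_{\Bbbk}\mathcal H_{8p}=8p$. 2. The coradical of $\mathcal H_{8p}$ is the subalgebra generated by $a$ and $x$; it is a Hopf subalgebra, isomorphic to $\Bbbk^{\mathrm{Dic}_p}$ as a Hopf algebra. 3. The coradical of the dual Hopf algebra $\mathcal H_{8p}^*$ is isomorphic as a coalgebra to $\Bbbk C_{2p}\oplus\mathcal M^*(2,\Bbbk)^{p}$ (one copy of the group coalgebra $\Bbbk C_{2p}$ and $p$ copies of $\mathcal M^*(2,\Bbbk)$), by an isomorphism whose restriction to $\Bbbk C_{2p}$ is a map of Hopf algebras to $\mathcal H_{8p}^*$. -/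

import Mathlib

open scoped TensorProduct
universe v

set_option linter.unusedSectionVars false

noncomputable section

/-- The linear dual `A^* = Hom_k(A, k)`. When `A` is a coalgebra it carries the convolution product,
when `A` is a finite-dimensional algebra it carries the comultiplication dual to the product of `A`
(so `Δ(f) = ∑ fᵢ ⊗ gᵢ` where `f (x * y) = ∑ fᵢ x * gᵢ y`) and the counit `f ↦ f 1`; when `A` is a
finite-dimensional Hopf algebra, `A^*` is the dual Hopf algebra, with antipode `f ↦ f ∘ S`. -/
def LinDual (k A : Type*) [Field k] [AddCommGroup A] [Module k A] : Type _ :=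
  A →ₗ[k] k

namespace LinDual
open Module Coalgebra

section Basic
variable {k A : Type*} [Field k] [AddCommGroup A] [Module k A]

instance : AddCommGroup (LinDual k A) := inferInstanceAs (AddCommGroup (A →ₗ[k] k))
instance : Module k (LinDual k A) := inferInstanceAs (Module k (A →ₗ[k] k))
instance : FunLike (LinDual k A) A k := inferInstanceAs (FunLike (A →ₗ[k] k) A k)
instance : LinearMapClass (LinDual k A) k A k :=
  inferInstanceAs (LinearMapClass (A →ₗ[k] k) k A k)

variable (k A) in
def toDual : LinDual k A ≃ₗ[k] Dual k A := LinearEquiv.refl k (Dual k A)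

@[simp] theorem toDual_apply (f : LinDual k A) (x : A) : toDual k A f x = f x := rfl
@[simp] theorem toDual_symm_apply (f : Dual k A) (x : A) : (toDual k A).symm f x = f x := rfl
@[ext] theorem ext {f g : LinDual k A} (h : ∀ x, f x = g x) : f = g := LinearMap.ext h
@[simp] theorem zero_apply (x : A) : (0 : LinDual k A) x = 0 := rfl
@[simp] theorem add_apply (f g : LinDual k A) (x : A) : (f + g) x = f x + g x := rfl
@[simp] theorem smul_apply (c : k) (f : LinDual k A) (x : A) : (c • f) x = c * f x := rfl

end Basic

section Alg
variable {k C : Type*} [Field k] [AddCommGroup C] [Module k C] [Coalgebra k C]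

/-- Convolution: `(f * g)(x) = ∑ f(x₁) g(x₂)`. -/
instance : Mul (LinDual k C) where
  mul f g := (toDual k C).symm
    (LinearMap.mul' k k ∘ₗ TensorProduct.map (toDual k C f) (toDual k C g) ∘ₗ comul)

instance : One (LinDual k C) where
  one := (toDual k C).symm counit

theorem mul_apply (f g : LinDual k C) (x : C) :
    (f * g) x = LinearMap.mul' k k (TensorProduct.map (toDual k C f) (toDual k C g) (comul x)) :=
  rfl

theorem repr_mul_apply {ι : Type*} {x : C} (X : Coalgebra.Repr k x ι) (f g : LinDual k C) :
    (f * g) x = ∑ i ∈ X.index, f (X.left i) * g (X.right i) := by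
  rw [mul_apply, ← X.eq]
  simp

@[simp] theorem one_apply (x : C) : (1 : LinDual k C) x = counit (R := k) x := rfl

/-- Comparison with Mathlib's convolution algebra. -/
def toConv (f : LinDual k C) : WithConv (C →ₗ[k] k) := WithConv.toConv (toDual k C f)

theorem toConv_injective : Function.Injective (toConv (k := k) (C := C)) := fun _ _ h =>
  (toDual k C).injective (WithConv.toConv_injective h)

instance : Ring (LinDual k C) where
  __ := (inferInstance : AddCommGroup (LinDual k C))
  left_distrib f g h := toConv_injective (mul_add (toConv f) (toConv g) (toConv h))
  right_distrib f g h := toConv_injective (add_mul (toConv f) (toConv g) (toConv h))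
  zero_mul f := toConv_injective (zero_mul (toConv f))
  mul_zero f := toConv_injective (mul_zero (toConv f))
  mul_assoc f g h := toConv_injective (mul_assoc (toConv f) (toConv g) (toConv h))
  one_mul f := toConv_injective (one_mul (toConv f))
  mul_one f := toConv_injective (mul_one (toConv f))

instance : Algebra k (LinDual k C) :=
  Algebra.ofModule
    (fun c f g => toConv_injective (smul_mul_assoc c (toConv f) (toConv g)))
    (fun c f g => toConv_injective (mul_smul_comm c (toConv f) (toConv g)))

end Alg

section Coalg
variable (k A : Type*) [Field k] [Ring A] [Algebra k A] [Module.Finite k A]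

/-- The isomorphism `A^* ⊗ A^* ≃ (A ⊗ A)^*`, `(f ⊗ g)(x ⊗ y) = f x * g y`. -/
def pairing : LinDual k A ⊗[k] LinDual k A ≃ₗ[k] Dual k (A ⊗[k] A) :=
  (TensorProduct.congr (toDual k A) (toDual k A)).trans (TensorProduct.dualDistribEquiv k A A)

variable {k A} in
@[simp] theorem pairing_tmul (f g : LinDual k A) (x y : A) :
    pairing k A (f ⊗ₜ g) (x ⊗ₜ y) = f x * g y := rfl

instance instCoalgebraStruct : CoalgebraStruct k (LinDual k A) where
  comul := (pairing k A).symm.toLinearMap ∘ₗ (LinearMap.mul' k A).dualMap ∘ₗ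
    (toDual k A).toLinearMap
  counit := Dual.eval k A 1 ∘ₗ (toDual k A).toLinearMap

variable {k A}

@[simp] theorem pairing_comul (f : LinDual k A) (x y : A) :
    pairing k A (comul (R := k) f) (x ⊗ₜ y) = f (x * y) := by
  simp [CoalgebraStruct.comul]

@[simp] theorem counit_apply (f : LinDual k A) : counit (R := k) f = f 1 := rfl

theorem pairing_ext {s t : LinDual k A ⊗[k] LinDual k A}
    (h : ∀ x y, pairing k A s (x ⊗ₜ y) = pairing k A t (x ⊗ₜ y)) : s = t := by
  apply (pairing k A).injective
  ext x y
  exact h x y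

def pairing₃ : LinDual k A ⊗[k] (LinDual k A ⊗[k] LinDual k A) ≃ₗ[k] Dual k (A ⊗[k] (A ⊗[k] A)) :=
  (TensorProduct.congr (toDual k A) (pairing k A)).trans
    (TensorProduct.dualDistribEquiv k A (A ⊗[k] A))

theorem pairing₃_tmul (f : LinDual k A) (t : LinDual k A ⊗[k] LinDual k A) (x : A)
    (w : A ⊗[k] A) : pairing₃ (f ⊗ₜ t) (x ⊗ₜ w) = f x * pairing k A t w := rfl

theorem pairing₃_lTensor (t : LinDual k A ⊗[k] LinDual k A) (x y z : A) :
    pairing₃ (comul.lTensor (LinDual k A) t) (x ⊗ₜ (y ⊗ₜ z)) = pairing k A t (x ⊗ₜ (y * z)) := by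
  induction t with
  | zero => simp
  | tmul f g => simp [pairing₃_tmul]
  | add s t hs ht => simp [hs, ht]

theorem pairing₃_assoc (t : LinDual k A ⊗[k] LinDual k A) (g : LinDual k A) (x y z : A) :
    pairing₃ (TensorProduct.assoc k _ _ _ (t ⊗ₜ g)) (x ⊗ₜ (y ⊗ₜ z)) =
      pairing k A t (x ⊗ₜ y) * g z := by
  induction t with
  | zero => simp
  | tmul f g => simp [pairing₃_tmul, mul_assoc]
  | add s t hs ht => simp [hs, ht, TensorProduct.add_tmul, add_mul]

theorem pairing₃_rTensor (t : LinDual k A ⊗[k] LinDual k A) (x y z : A) :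
    pairing₃ (TensorProduct.assoc k _ _ _ (comul.rTensor (LinDual k A) t)) (x ⊗ₜ (y ⊗ₜ z)) =
      pairing k A t ((x * y) ⊗ₜ z) := by
  induction t with
  | zero => simp
  | tmul f g => simp [pairing₃_assoc]
  | add s t hs ht => simp [hs, ht]

theorem lid_rTensor_counit (t : LinDual k A ⊗[k] LinDual k A) (y : A) :
    (TensorProduct.lid k _ (counit.rTensor (LinDual k A) t)) y = pairing k A t (1 ⊗ₜ y) := by
  induction t with
  | zero => simp
  | tmul f g => simp
  | add s t hs ht => simp [hs, ht]

theorem rid_lTensor_counit (t : LinDual k A ⊗[k] LinDual k A) (x : A) :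
    (TensorProduct.rid k _ (counit.lTensor (LinDual k A) t)) x = pairing k A t (x ⊗ₜ 1) := by
  induction t with
  | zero => simp
  | tmul f g => simp [mul_comm]
  | add s t hs ht => simp [hs, ht]

instance instCoalgebra : Coalgebra k (LinDual k A) where
  coassoc := by
    ext f : 1
    apply pairing₃.injective
    ext x y z
    simp [pairing₃_rTensor, pairing₃_lTensor, mul_assoc]
  rTensor_counit_comp_comul := by
    ext f : 1
    apply (TensorProduct.lid k (LinDual k A)).injective
    ext y
    simp [lid_rTensor_counit]
  lTensor_counit_comp_comul := by
    ext f : 1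
    apply (TensorProduct.rid k (LinDual k A)).injective
    ext y
    simp [rid_lTensor_counit]

end Coalg

section Bialg
variable {k H : Type*} [Field k] [Ring H] [Bialgebra k H] [Module.Finite k H]

theorem pairing_mul {ι κ : Type*} (s t : LinDual k H ⊗[k] LinDual k H) {x y : H}
    (X : Coalgebra.Repr k x ι) (Y : Coalgebra.Repr k y κ) :
    pairing k H (s * t) (x ⊗ₜ y) = ∑ i ∈ X.index, ∑ j ∈ Y.index,
      pairing k H s (X.left i ⊗ₜ Y.left j) * pairing k H t (X.right i ⊗ₜ Y.right j) := by
  induction s with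
  | zero => simp
  | add s s' hs hs' => simp [hs, hs', add_mul, Finset.sum_add_distrib]
  | tmul f g =>
    induction t with
    | zero => simp
    | add t t' ht ht' => simp [ht, ht', mul_add, Finset.sum_add_distrib]
    | tmul f' g' =>
      rw [Algebra.TensorProduct.tmul_mul_tmul, pairing_tmul, repr_mul_apply X, repr_mul_apply Y,
        Finset.sum_mul_sum]
      refine Finset.sum_congr rfl fun i _ => Finset.sum_congr rfl fun j _ => ?_
      simp only [pairing_tmul]
      ring

instance instBialgebra : Bialgebra k (LinDual k H) :=
  .mk' k (LinDual k H)
    (by simp)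
    (by intro f g; simp [mul_apply, Algebra.TensorProduct.one_def])
    (by
      apply pairing_ext
      intro x y
      simp [Algebra.TensorProduct.one_def])
    (by
      intro f g
      apply pairing_ext
      intro x y
      rw [pairing_mul _ _ (ℛ k x) (ℛ k y), pairing_comul]
      simp only [pairing_comul]
      rw [mul_apply, Bialgebra.comul_mul, ← (ℛ k x).eq, ← (ℛ k y).eq,
        Finset.sum_mul_sum]
      simp)

end Bialg

section Hopf
variable {k H : Type*} [Field k] [Ring H] [HopfAlgebra k H] [Module.Finite k H]

instance instHopfAlgebraStruct : HopfAlgebraStruct k (LinDual k H) where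
  antipode := (toDual k H).symm.toLinearMap ∘ₗ
    (HopfAlgebra.antipode k (A := H)).dualMap ∘ₗ (toDual k H).toLinearMap

theorem antipode_apply (f : LinDual k H) (x : H) :
    (HopfAlgebra.antipode k f) x = f (HopfAlgebra.antipode k x) := rfl

theorem mul_antipode_rTensor {ι : Type*} (t : LinDual k H ⊗[k] LinDual k H) {x : H}
    (X : Coalgebra.Repr k x ι) :
    (LinearMap.mul' k (LinDual k H) ((HopfAlgebra.antipode k).rTensor _ t)) x =
      ∑ i ∈ X.index, pairing k H t (HopfAlgebra.antipode k (X.left i) ⊗ₜ X.right i) := by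
  induction t with
  | zero => simp
  | add s t hs ht => simp [hs, ht, Finset.sum_add_distrib]
  | tmul f g =>
    rw [LinearMap.rTensor_tmul, LinearMap.mul'_apply, repr_mul_apply X]
    rfl

theorem mul_antipode_lTensor {ι : Type*} (t : LinDual k H ⊗[k] LinDual k H) {x : H}
    (X : Coalgebra.Repr k x ι) :
    (LinearMap.mul' k (LinDual k H) ((HopfAlgebra.antipode k).lTensor _ t)) x =
      ∑ i ∈ X.index, pairing k H t (X.left i ⊗ₜ HopfAlgebra.antipode k (X.right i)) := by
  induction t with
  | zero => simp
  | add s t hs ht => simp [hs, ht, Finset.sum_add_distrib]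
  | tmul f g =>
    rw [LinearMap.lTensor_tmul, LinearMap.mul'_apply, repr_mul_apply X]
    rfl

instance instHopfAlgebra : HopfAlgebra k (LinDual k H) where
  mul_antipode_rTensor_comul := by
    ext f x
    have h := congrArg f (HopfAlgebra.sum_antipode_mul_eq_algebraMap_counit (ℛ k x))
    simp only [LinearMap.comp_apply, mul_antipode_rTensor _ (ℛ k x), pairing_comul]
    rw [← map_sum, h]
    simp [Algebra.algebraMap_eq_smul_one, mul_comm]
  mul_antipode_lTensor_comul := by
    ext f x
    have h := congrArg f (HopfAlgebra.sum_mul_antipode_eq_algebraMap_counit (ℛ k x))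
    simp only [LinearMap.comp_apply, mul_antipode_lTensor _ (ℛ k x), pairing_comul]
    rw [← map_sum, h]
    simp [Algebra.algebraMap_eq_smul_one, mul_comm]

end Hopf
end LinDual

section Coradical
variable (k : Type*) [Field k] {C : Type*} [AddCommGroup C] [Module k C] [Coalgebra k C]

/-- `V` is a subcoalgebra of `C`: `Δ(V) ⊆ V ⊗ V`. -/
def IsSubcoalgebra (V : Submodule k C) : Prop :=
  V.map (Coalgebra.comul (R := k) (A := C)) ≤
    LinearMap.range (TensorProduct.map V.subtype V.subtype)

/-- `V` is a simple subcoalgebra: a nonzero subcoalgebra whose only subcoalgebras are `0` and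
itself. -/
structure IsSimpleSubcoalgebra (V : Submodule k C) : Prop where
  isSubcoalgebra : IsSubcoalgebra k V
  ne_bot : V ≠ ⊥
  eq_bot_or_eq : ∀ W : Submodule k C, IsSubcoalgebra k W → W ≤ V → W = ⊥ ∨ W = V

variable (C) in
/-- The coradical: the sum of all simple subcoalgebras. -/
def coradical : Submodule k C := sSup {V | IsSimpleSubcoalgebra k V}

variable (C) in
/-- `C` is pointed: its coradical is spanned by the group-like elements. -/
def IsPointedCoalgebra : Prop :=
  coradical k C = Submodule.span k {c : C | IsGroupLikeElem k c}

end Coradical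

/-- `A` is basic: all its simple modules are one-dimensional over `k`. (Each simple `A`-module is
isomorphic to a quotient of `A`, so the universe of `A` is large enough.) -/
def IsBasicAlgebra (k : Type*) [Field k] (A : Type v) [Ring A] [Algebra k A] : Prop :=
  ∀ (M : Type v) [AddCommGroup M] [Module k M] [Module A M] [IsScalarTower k A M],
    IsSimpleModule A M → Module.finrank k M = 1

/-- The Hopf algebra `k^G = (kG)^*` of functions on a finite group `G`. -/
abbrev FunctionHopf (k : Type*) [Field k] (G : Type*) [Group G] : Type _ :=
  LinDual k (MonoidAlgebra k G)

/-- The simple coalgebra `M^*(n,k)`, dual of the matrix algebra `M_n(k)`. -/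
abbrev MatrixCoalgebra (k : Type*) [Field k] (n : ℕ) : Type _ :=
  LinDual k (Matrix (Fin n) (Fin n) k)

inductive DicGen
  | x
  | y

/-- Relators of the presentation `⟨x, y | x⁴ = yⁿ = 1, x y x⁻¹ = y⁻¹⟩`. -/
def dicRels (n : ℕ) : Set (FreeGroup DicGen) :=
  {FreeGroup.of .x ^ 4, FreeGroup.of .y ^ n,
    FreeGroup.of .x * FreeGroup.of .y * (FreeGroup.of .x)⁻¹ * FreeGroup.of .y}

/-- For odd `n` the group with this presentation is Mathlib's dicyclic group of order `4n`. -/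
theorem presentedGroup_dicRels_mulEquiv {n : ℕ} (hn : Odd n) :
    Nonempty (PresentedGroup (dicRels n) ≃* QuaternionGroup n) := by
  obtain ⟨m, hm⟩ := hn
  let F : DicGen → QuaternionGroup n := fun
    | .x => QuaternionGroup.xa 0
    | .y => QuaternionGroup.a 2
  have z : (2 * n : ZMod (2 * n)) = 0 := by
    exact_mod_cast ZMod.natCast_self (2 * n)
  have apow : ∀ j : ℕ, (QuaternionGroup.a (2 : ZMod (2 * n))) ^ j = QuaternionGroup.a (2 * j) := by
    intro j
    induction j with
    | zero => rw [pow_zero, QuaternionGroup.one_def]; simp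
    | succ j ih => rw [pow_succ, ih, QuaternionGroup.a_mul_a]; congr 1; push_cast; ring
  have hF : ∀ r ∈ dicRels n, FreeGroup.lift F r = 1 := by
    rintro r (rfl | rfl | rfl)
    · simp only [map_pow, FreeGroup.lift_apply_of, F]
      rw [show 4 = 2 * 2 from rfl, pow_mul, QuaternionGroup.xa_sq, sq, QuaternionGroup.a_mul_a,
        ← two_mul, z, QuaternionGroup.one_def]
    · simp only [map_pow, FreeGroup.lift_apply_of, F]
      rw [apow, z, QuaternionGroup.one_def]
    · simp only [map_mul, map_inv, FreeGroup.lift_apply_of, F]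
      rw [mul_eq_one_iff_eq_inv, mul_inv_eq_iff_eq_mul]
      change QuaternionGroup.xa (0 + 2) = QuaternionGroup.a (-2) * QuaternionGroup.xa 0
      rw [QuaternionGroup.a_mul_xa]
      congr 1
      ring
  let f : PresentedGroup (dicRels n) →* QuaternionGroup n := PresentedGroup.toGroup hF
  let x : PresentedGroup (dicRels n) := PresentedGroup.of .x
  let y : PresentedGroup (dicRels n) := PresentedGroup.of .y
  have fx : f x = QuaternionGroup.xa 0 := PresentedGroup.toGroup.of hF
  have fy : f y = QuaternionGroup.a 2 := PresentedGroup.toGroup.of hF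
  have x4 : x ^ 4 = 1 := PresentedGroup.one_of_mem (rels := dicRels n) (by simp [dicRels])
  have yn : y ^ n = 1 := PresentedGroup.one_of_mem (rels := dicRels n) (by simp [dicRels])
  have xyx : x * y * x⁻¹ * y = 1 :=
    PresentedGroup.one_of_mem (rels := dicRels n) (by simp [dicRels])
  have hy : x * y * x⁻¹ = y⁻¹ := mul_eq_one_iff_eq_inv.1 xyx
  let u := y ^ (m + 1) * x ^ 2
  have hc : Commute (x ^ 2) y := by
    have h1 : x * y = y⁻¹ * x := mul_inv_eq_iff_eq_mul.1 hy
    have h2 : x * y⁻¹ = y * x := by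
      have := congrArg (·⁻¹) hy
      simp only [mul_inv_rev, inv_inv, ← mul_assoc] at this
      exact mul_inv_eq_iff_eq_mul.1 this
    rw [Commute, SemiconjBy, sq, mul_assoc, h1, ← mul_assoc, h2, mul_assoc]
  have fu : f u = QuaternionGroup.a 1 := by
    rw [map_mul, map_pow, map_pow, fx, fy, apow, QuaternionGroup.xa_sq, QuaternionGroup.a_mul_a]
    congr 1
    have h : (n : ZMod (2 * n)) = 2 * m + 1 := by
      have := congrArg (Nat.cast : ℕ → ZMod (2 * n)) hm
      exact_mod_cast this
    have h' : (2 * (m + 1 : ℕ) + n : ZMod (2 * n)) = 2 * n + 1 := by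
      push_cast
      linear_combination (-1 : ZMod (2 * n)) * h
    rw [h', z, zero_add]
  have un : u ^ n = x ^ 2 := by
    have h : (x ^ 2) ^ n = x ^ 2 := by
      rw [← pow_mul, show 2 * n = 4 * m + 2 by omega, pow_add, pow_mul, x4, one_pow,
        one_mul]
    rw [(hc.symm.pow_left (m + 1)).mul_pow, h, ← pow_mul, mul_comm, pow_mul, yn, one_pow, one_mul]
  have u2 : u ^ 2 = y := by
    rw [(hc.symm.pow_left (m + 1)).mul_pow, ← pow_mul, ← pow_mul, x4, mul_one,
      show (m + 1) * 2 = n + 1 by omega, pow_succ, yn, one_mul]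
  have xu : ∀ j : ℤ, u ^ j * x = x * u ^ (-j) := by
    intro j
    have h1 : x * u * x⁻¹ = u⁻¹ := by
      have h2 : x * x ^ 2 * x⁻¹ = x ^ 2 := by rw [← pow_succ', pow_succ, mul_inv_cancel_right]
      have h3 : (x ^ 2)⁻¹ = x ^ 2 := by rw [inv_eq_iff_mul_eq_one, ← pow_add, x4]
      have h4 : x * u * x⁻¹ = (x * y * x⁻¹) ^ (m + 1) * (x * x ^ 2 * x⁻¹) := by
        rw [conj_pow]; simp only [u]; group
      rw [h4, hy, h2, mul_inv_rev, h3, inv_pow, (hc.pow_right (m + 1)).inv_right.eq]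
    have h5 : x * u ^ (-j) * x⁻¹ = u ^ j := by rw [← conj_zpow, h1, inv_zpow', neg_neg]
    rw [← h5, inv_mul_cancel_right]
  have fuj : ∀ j : ℤ, f (u ^ j) = QuaternionGroup.a j := by
    intro j
    rw [map_zpow, fu]
    obtain ⟨r, rfl | rfl⟩ := j.eq_nat_or_neg
    · simp
    · rw [zpow_neg, zpow_natCast, QuaternionGroup.a_one_pow]
      exact congrArg QuaternionGroup.a (by simp)
  have norm : ∀ w : PresentedGroup (dicRels n), ∃ j : ℤ, w = u ^ j ∨ w = x * u ^ j := by
    have hxx : x * x = u ^ (n : ℤ) := by rw [zpow_natCast, un, sq]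
    intro w
    have hw : w ∈ Subgroup.closure (Set.range (PresentedGroup.of (rels := dicRels n))) := by
      rw [PresentedGroup.closure_range_of]; trivial
    induction hw using Subgroup.closure_induction with
    | mem w hw =>
      obtain ⟨g, rfl⟩ := hw
      cases g
      · exact ⟨0, Or.inr (by simp [x])⟩
      · exact ⟨2, Or.inl (by exact_mod_cast u2.symm)⟩
    | one => exact ⟨0, Or.inl (by simp)⟩
    | mul a b _ _ ha hb =>
      obtain ⟨i, rfl | rfl⟩ := ha <;> obtain ⟨j, rfl | rfl⟩ := hb
      · exact ⟨i + j, Or.inl (zpow_add _ _ _).symm⟩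
      · exact ⟨-i + j, Or.inr (by rw [← mul_assoc, xu, mul_assoc, zpow_add])⟩
      · exact ⟨i + j, Or.inr (by rw [mul_assoc, zpow_add])⟩
      · refine ⟨n + (-i + j), Or.inl ?_⟩
        rw [mul_assoc, ← mul_assoc (u ^ i), xu, ← mul_assoc, ← mul_assoc, hxx, mul_assoc,
          ← zpow_add, ← zpow_add]
    | inv a _ ha =>
      obtain ⟨i, rfl | rfl⟩ := ha
      · exact ⟨-i, Or.inl (zpow_neg _ _).symm⟩
      · refine ⟨-(n : ℤ) + i, Or.inr ?_⟩
        rw [inv_eq_iff_mul_eq_one, mul_assoc, ← mul_assoc (u ^ i), xu, ← mul_assoc, ← mul_assoc,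
          hxx, ← zpow_add, ← zpow_add, show (n : ℤ) + -i + (-n + i) = 0 by ring, zpow_zero]
  refine ⟨MulEquiv.ofBijective f ⟨?_, ?_⟩⟩
  · refine (injective_iff_map_eq_one f).2 fun w hw => ?_
    obtain ⟨j, rfl | rfl⟩ := norm w
    · rw [fuj, QuaternionGroup.one_def, QuaternionGroup.a.injEq,
        ZMod.intCast_zmod_eq_zero_iff_dvd] at hw
      obtain ⟨c, rfl⟩ := hw
      rw [zpow_mul, zpow_natCast, mul_comm, pow_mul, un, ← pow_mul, x4, one_zpow]
    · rw [map_mul, fuj, fx, QuaternionGroup.xa_mul_a, QuaternionGroup.one_def] at hw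
      cases hw
  · rintro (j | j)
    · exact ⟨u ^ (j.cast : ℤ), by rw [fuj]; simp⟩
    · exact ⟨x * u ^ (j.cast : ℤ), by rw [map_mul, fuj, fx]; simp⟩

/-- The three generators `a`, `x`, `z` of the algebra `H_{8p}`. -/
inductive H8pGen
  | a
  | x
  | z

/-- The defining relations of `H_{8p}`: `a² = 1`, `x^{2p} = 1`, `z² = a - 1`, `ax = xa`, `az = za`,
`xz = -zx`. -/
inductive H8pRel (k : Type*) [Field k] (p : ℕ) :
    FreeAlgebra k H8pGen → FreeAlgebra k H8pGen → Prop
  | a_sq : H8pRel k p (FreeAlgebra.ι k .a ^ 2) 1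
  | x_pow : H8pRel k p (FreeAlgebra.ι k .x ^ (2 * p)) 1
  | z_sq : H8pRel k p (FreeAlgebra.ι k .z ^ 2) (FreeAlgebra.ι k .a - 1)
  | ax : H8pRel k p (FreeAlgebra.ι k .a * FreeAlgebra.ι k .x)
      (FreeAlgebra.ι k .x * FreeAlgebra.ι k .a)
  | az : H8pRel k p (FreeAlgebra.ι k .a * FreeAlgebra.ι k .z)
      (FreeAlgebra.ι k .z * FreeAlgebra.ι k .a)
  | xz : H8pRel k p (FreeAlgebra.ι k .x * FreeAlgebra.ι k .z)
      (-(FreeAlgebra.ι k .z * FreeAlgebra.ι k .x))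

/-- The algebra `H_{8p}` over `k`, presented by generators and relations. The last argument is the
choice `√-1 = i` in `k`; the algebra does not depend on it, but its comultiplication does, through
the group-like element `g = (e₀ + i e₁) x^p`. -/
def H8p (k : Type*) [Field k] (p : ℕ) (_i : {c : k // c ^ 2 = -1}) : Type _ :=
  RingQuot (H8pRel k p)

namespace H8p
open MulOpposite

section Alg
variable {k : Type*} [Field k] {p : ℕ} {i : {c : k // c ^ 2 = -1}}

instance : Ring (H8p k p i) := inferInstanceAs (Ring (RingQuot (H8pRel k p)))
instance : Algebra k (H8p k p i) := inferInstanceAs (Algebra k (RingQuot (H8pRel k p)))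

variable (k p i) in
def mk : FreeAlgebra k H8pGen →ₐ[k] H8p k p i := RingQuot.mkAlgHom k (H8pRel k p)

variable (k p i) in
def a : H8p k p i := mk k p i (FreeAlgebra.ι k .a)
variable (k p i) in
def x : H8p k p i := mk k p i (FreeAlgebra.ι k .x)
variable (k p i) in
def z : H8p k p i := mk k p i (FreeAlgebra.ι k .z)

local notation "A" => a k p i
local notation "X" => x k p i
local notation "Z" => z k p i

theorem mk_rel {u v : FreeAlgebra k H8pGen} (h : H8pRel k p u v) : mk k p i u = mk k p i v :=
  RingQuot.mkAlgHom_rel k h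

theorem a_sq : A ^ 2 = 1 := by
  simpa [a] using mk_rel (i := i) (H8pRel.a_sq (k := k) (p := p))
theorem x_pow : X ^ (2 * p) = 1 := by
  simpa [x] using mk_rel (i := i) (H8pRel.x_pow (k := k) (p := p))
theorem z_sq : Z ^ 2 = A - 1 := by
  simpa [a, z] using mk_rel (i := i) (H8pRel.z_sq (k := k) (p := p))
theorem ax : A * X = X * A := by
  simpa [a, x] using mk_rel (i := i) (H8pRel.ax (k := k) (p := p))
theorem az : A * Z = Z * A := by
  simpa [a, z] using mk_rel (i := i) (H8pRel.az (k := k) (p := p))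
theorem xz : X * Z = -(Z * X) := by
  simpa [x, z] using mk_rel (i := i) (H8pRel.xz (k := k) (p := p))

section Lift
variable {B : Type*} [Ring B] [Algebra k B]

variable (i) in
def lift (a' x' z' : B) (h1 : a' ^ 2 = 1) (h2 : x' ^ (2 * p) = 1) (h3 : z' ^ 2 = a' - 1)
    (h4 : a' * x' = x' * a') (h5 : a' * z' = z' * a') (h6 : x' * z' = -(z' * x')) :
    H8p k p i →ₐ[k] B :=
  RingQuot.liftAlgHom k ⟨FreeAlgebra.lift k (fun | .a => a' | .x => x' | .z => z'), by
    intro u v h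
    cases h <;> simp [*]⟩

variable {a' x' z' : B} (h1 : a' ^ 2 = 1) (h2 : x' ^ (2 * p) = 1) (h3 : z' ^ 2 = a' - 1)
    (h4 : a' * x' = x' * a') (h5 : a' * z' = z' * a') (h6 : x' * z' = -(z' * x'))

@[simp] theorem lift_a : lift i a' x' z' h1 h2 h3 h4 h5 h6 A = a' := by
  simp only [lift, a, mk]
  exact (RingQuot.liftAlgHom_mkAlgHom_apply ..).trans (by simp)
@[simp] theorem lift_x : lift i a' x' z' h1 h2 h3 h4 h5 h6 X = x' := by
  simp only [lift, x, mk]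
  exact (RingQuot.liftAlgHom_mkAlgHom_apply ..).trans (by simp)
@[simp] theorem lift_z : lift i a' x' z' h1 h2 h3 h4 h5 h6 Z = z' := by
  simp only [lift, z, mk]
  exact (RingQuot.liftAlgHom_mkAlgHom_apply ..).trans (by simp)

theorem hom_ext {f g : H8p k p i →ₐ[k] B} (ha : f A = g A) (hx : f X = g X) (hz : f Z = g Z) :
    f = g := by
  apply RingQuot.ringQuot_ext' k
  apply FreeAlgebra.hom_ext
  funext j
  cases j
  exacts [ha, hx, hz]

end Lift

theorem induction {P : H8p k p i → Prop} (halg : ∀ r, P (algebraMap k _ r)) (ha : P A) (hx : P X)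
    (hz : P Z) (hadd : ∀ u v, P u → P v → P (u + v)) (hmul : ∀ u v, P u → P v → P (u * v))
    (h : H8p k p i) : P h := by
  obtain ⟨w, rfl⟩ : ∃ w, mk k p i w = h := RingQuot.mkAlgHom_surjective k (H8pRel k p) h
  induction w using FreeAlgebra.induction with
  | grade0 r => simpa using halg r
  | grade1 j => cases j; exacts [ha, hx, hz]
  | mul u v hu hv => simpa using hmul _ _ hu hv
  | add u v hu hv => simpa using hadd _ _ hu hv

variable (k p i) in
def monomialSpan : Submodule k (H8p k p i) :=
  Submodule.span k (Set.range fun t : Fin 2 × Fin (2 * p) × Fin 2 =>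
    A ^ (t.1 : ℕ) * X ^ (t.2.1 : ℕ) * Z ^ (t.2.2 : ℕ))

theorem monomial_mem (hp : p ≠ 0) (n m l : ℕ) : A ^ n * X ^ m * Z ^ l ∈ monomialSpan k p i := by
  induction l using Nat.strong_induction_on generalizing n m with
  | _ l ih =>
    by_cases hl : l < 2
    · rw [pow_eq_pow_mod n (a_sq (k := k) (p := p) (i := i)),
        pow_eq_pow_mod m (x_pow (k := k) (p := p) (i := i))]
      exact Submodule.subset_span
        ⟨(⟨n % 2, Nat.mod_lt _ two_pos⟩, ⟨m % (2 * p), Nat.mod_lt _ (by positivity)⟩, ⟨l, hl⟩), rfl⟩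
    · obtain ⟨l, rfl⟩ : ∃ r, l = r + 2 := ⟨l - 2, by omega⟩
      have hc : X ^ m * A = A * X ^ m := ((show Commute A X from ax).pow_right m).symm.eq
      have h : A ^ n * X ^ m * Z ^ (l + 2) = A ^ (n + 1) * X ^ m * Z ^ l - A ^ n * X ^ m * Z ^ l := by
        rw [add_comm l 2, pow_add, z_sq, pow_succ, sub_mul, mul_sub, one_mul, mul_assoc _ _ (A * _),
          ← mul_assoc _ A, hc]
        simp only [mul_assoc]
      rw [h]
      exact Submodule.sub_mem _ (ih l (by omega) _ _) (ih l (by omega) _ _)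

theorem z_mul_pow (m : ℕ) : Z * X ^ m = (-1) ^ m * (X ^ m * Z) := by
  have hzx : Z * X = -(X * Z) := by rw [xz, neg_neg]
  induction m with
  | zero => simp
  | succ m ih =>
    rw [pow_succ, ← mul_assoc, ih, mul_assoc, mul_assoc, hzx, pow_succ]
    simp [mul_assoc]

theorem mul_mem (hp : p ≠ 0) (h : H8p k p i) :
    ∀ v ∈ monomialSpan k p i, h * v ∈ monomialSpan k p i := by
  have gen : ∀ c : H8p k p i, (∀ n m l, c * (A ^ n * X ^ m * Z ^ l) ∈ monomialSpan k p i) →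
      ∀ v ∈ monomialSpan k p i, c * v ∈ monomialSpan k p i := by
    intro c hc v hv
    induction hv using Submodule.span_induction with
    | mem v hv => obtain ⟨t, rfl⟩ := hv; exact hc _ _ _
    | zero => simp
    | add u v _ _ hu hv => rw [mul_add]; exact Submodule.add_mem _ hu hv
    | smul r v _ hv => rw [mul_smul_comm]; exact Submodule.smul_mem _ _ hv
  induction h using induction with
  | halg r =>
    intro v hv
    rw [← Algebra.smul_def]
    exact Submodule.smul_mem _ _ hv
  | hadd u v hu hv => intro w hw; rw [add_mul]; exact Submodule.add_mem _ (hu w hw) (hv w hw)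
  | hmul u v hu hv => intro w hw; rw [mul_assoc]; exact hu _ (hv w hw)
  | ha =>
    refine gen _ fun n m l => ?_
    rw [← mul_assoc, ← mul_assoc, ← pow_succ']
    exact monomial_mem hp _ _ _
  | hx =>
    refine gen _ fun n m l => ?_
    have hc : X * A ^ n = A ^ n * X := ((show Commute A X from ax).symm.pow_right n).eq
    rw [← mul_assoc, ← mul_assoc, hc, mul_assoc _ X, ← pow_succ']
    exact monomial_mem hp _ _ _
  | hz =>
    refine gen _ fun n m l => ?_
    have hc : Z * A ^ n = A ^ n * Z := ((show Commute A Z from az).symm.pow_right n).eq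
    have h : Z * (A ^ n * X ^ m * Z ^ l) = ((-1 : k) ^ m) • (A ^ n * X ^ m * Z ^ (l + 1)) := by
      rw [← mul_assoc, ← mul_assoc, hc, mul_assoc _ Z, z_mul_pow, pow_succ']
      rcases neg_one_pow_eq_or k m with h | h <;> rcases Nat.even_or_odd m with h' | h' <;>
        simp [h'.neg_one_pow, mul_assoc]
    rw [h]
    exact Submodule.smul_mem _ _ (monomial_mem hp _ _ _)

theorem monomialSpan_eq_top (hp : p ≠ 0) : monomialSpan k p i = ⊤ := by
  refine eq_top_iff.2 fun h _ => ?_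
  have h1 : (1 : H8p k p i) ∈ monomialSpan k p i := by
    simpa using monomial_mem (k := k) (i := i) hp 0 0 0
  simpa using mul_mem hp h 1 h1

instance [hp : Fact (Odd p)] : Module.Finite k (H8p k p i) := by
  refine ⟨?_⟩
  rw [← monomialSpan_eq_top hp.out.pos.ne']
  exact Submodule.fg_span (Set.finite_range _)

variable (k p i) in
/-- `e₀ = (1 + a) / 2` -/
def e₀ : H8p k p i := (2⁻¹ : k) • (1 + A)
variable (k p i) in
/-- `e₁ = (1 - a) / 2` -/
def e₁ : H8p k p i := (2⁻¹ : k) • (1 - A)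
variable (k p i) in
/-- `x⁻¹ = x^{2p-1}` -/
def xinv : H8p k p i := X ^ (2 * p - 1)
variable (k p i) in
/-- `g = (e₀ + √-1 e₁) x^p` -/
def g : H8p k p i := (e₀ k p i + (i : k) • e₁ k p i) * X ^ p

local notation "E₀" => e₀ k p i
local notation "E₁" => e₁ k p i
local notation "Y" => xinv k p i
local notation "G" => g k p i

theorem aa : A * A = 1 := by rw [← sq, a_sq]
theorem zz : Z * Z = A - 1 := by rw [← sq, z_sq]
theorem a_e₀ : A * E₀ = E₀ := by simp [e₀, mul_add, aa, add_comm]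
theorem a_e₁ : A * E₁ = -E₁ := by simp [e₁, mul_sub, aa, ← smul_neg]
theorem e₀_a : E₀ * A = E₀ := by simp [e₀, add_mul, aa, add_comm]
theorem e₁_a : E₁ * A = -E₁ := by simp [e₁, sub_mul, aa, ← smul_neg]
theorem commute_e₀ {w : H8p k p i} (h : Commute A w) : Commute E₀ w := by
  rw [e₀]; exact ((Commute.one_left w).add_left h).smul_left _
theorem commute_e₁ {w : H8p k p i} (h : Commute A w) : Commute E₁ w := by
  rw [e₁]; exact ((Commute.one_left w).sub_left h).smul_left _
theorem commute_ax : Commute A X := ax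
theorem commute_az : Commute A Z := az
theorem commute_axinv : Commute A Y := commute_ax.pow_right _
theorem commute_xxinv : Commute X Y := (Commute.refl X).pow_right _

theorem z_mul_pow_odd {m : ℕ} (hm : Odd m) : Z * X ^ m = -(X ^ m * Z) := by
  rw [z_mul_pow, hm.neg_one_pow, neg_one_mul]

section Char
variable [CharZero k]

theorem e₀_add_e₁ : E₀ + E₁ = 1 := by
  rw [e₀, e₁, ← smul_add, add_add_sub_cancel, ← two_smul k (1 : H8p k p i), smul_smul,
    inv_mul_cancel₀ two_ne_zero, one_smul]
theorem e₀_sub_e₁ : E₀ - E₁ = A := by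
  rw [e₀, e₁, ← smul_sub, add_sub_sub_cancel, ← two_smul k A, smul_smul,
    inv_mul_cancel₀ two_ne_zero, one_smul]
theorem e₀_e₁ : E₀ * E₁ = 0 := by
  rw [e₁, mul_smul_comm, mul_sub, e₀_a, mul_one, sub_self, smul_zero]
theorem e₁_e₀ : E₁ * E₀ = 0 := by
  rw [e₀, mul_smul_comm, mul_add, e₁_a, mul_one, add_neg_cancel, smul_zero]
theorem e₀_e₀ : E₀ * E₀ = E₀ := by
  have := congrArg (E₀ * ·) (e₀_add_e₁ (k := k) (p := p) (i := i))
  simpa [mul_add, e₀_e₁] using this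
theorem e₁_e₁ : E₁ * E₁ = E₁ := by
  have := congrArg (E₁ * ·) (e₀_add_e₁ (k := k) (p := p) (i := i))
  simpa [mul_add, e₁_e₀] using this

end Char

section Odd
variable [hp : Fact (Odd p)]

theorem odd_two_mul_sub_one : Odd (2 * p - 1) :=
  Nat.Even.sub_odd (by have := hp.out.pos; omega) (even_two_mul p) odd_one

theorem x_xinv : X * Y = 1 := by
  rw [xinv, ← pow_succ', Nat.sub_add_cancel (by have := hp.out.pos; omega), x_pow]
theorem xinv_x : Y * X = 1 := by rw [← commute_xxinv.eq, x_xinv]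
theorem xinv_pow_eq {n m : ℕ} (h : n + m = 2 * p) : Y ^ n = X ^ m := by
  have h1 : Y ^ n * X ^ n = 1 := by rw [← commute_xxinv.symm.mul_pow, xinv_x, one_pow]
  have h2 : X ^ n * X ^ m = 1 := by rw [← pow_add, h, x_pow]
  exact left_inv_eq_right_inv h1 h2
theorem z_xinv : Z * Y = -(Y * Z) := z_mul_pow_odd odd_two_mul_sub_one
theorem z_xp : Z * X ^ p = -(X ^ p * Z) := z_mul_pow_odd hp.out
theorem xp_xp : X ^ p * X ^ p = 1 := by rw [← pow_add, ← two_mul, x_pow]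
theorem a_pow_odd {m : ℕ} (hm : Odd m) : A ^ m = A := by
  obtain ⟨r, rfl⟩ := hm
  rw [pow_succ, pow_mul, a_sq, one_pow, one_mul]

theorem z_x : Z * X = -(X * Z) := by rw [xz, neg_neg]

theorem commute_ag : Commute A G := by
  have h0 : Commute A E₀ := (commute_e₀ (Commute.refl A)).symm
  have h1 : Commute A E₁ := (commute_e₁ (Commute.refl A)).symm
  exact (h0.add_right (h1.smul_right _)).mul_right (commute_ax.pow_right p)
theorem commute_xg : Commute X G := by
  have h0 : Commute X E₀ := (commute_e₀ commute_ax).symm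
  have h1 : Commute X E₁ := (commute_e₁ commute_ax).symm
  exact (h0.add_right (h1.smul_right _)).mul_right ((Commute.refl X).pow_right p)
theorem z_g : Z * G = -(G * Z) := by
  have h0 : Commute Z E₀ := (commute_e₀ commute_az).symm
  have h1 : Commute Z E₁ := (commute_e₁ commute_az).symm
  rw [g, ← mul_assoc, (h0.add_right (h1.smul_right _)).eq, mul_assoc, z_xp, mul_neg, mul_assoc]

variable [CharZero k]

theorem g_g : G * G = A := by
  have h0 : Commute (X ^ p) E₀ := (commute_e₀ (commute_ax.pow_right p)).symm
  have h1 : Commute (X ^ p) E₁ := (commute_e₁ (commute_ax.pow_right p)).symm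
  have hi : (i : k) * i = -1 := by rw [← sq, i.2]
  rw [g, mul_assoc, ← mul_assoc (X ^ p), (h0.add_right (h1.smul_right _)).eq, mul_assoc, xp_xp,
    mul_one]
  simp [mul_add, add_mul, e₀_e₀, e₁_e₁, e₀_e₁, e₁_e₀, smul_smul, hi, ← e₀_sub_e₁, sub_eq_add_neg]

local notation "HH" => H8p k p i ⊗[k] H8p k p i

variable (k p i) in
def comulX : HH := X ⊗ₜ (E₀ * X) + (A * Y) ⊗ₜ (E₁ * X)
variable (k p i) in
def comulZ : HH := G ⊗ₜ Z + Z ⊗ₜ 1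

theorem x_e₀ : X * E₀ = E₀ * X := (commute_e₀ commute_ax).symm.eq
theorem x_e₁ : X * E₁ = E₁ * X := (commute_e₁ commute_ax).symm.eq
theorem z_e₀ : Z * E₀ = E₀ * Z := (commute_e₀ commute_az).symm.eq
theorem z_e₁ : Z * E₁ = E₁ * Z := (commute_e₁ commute_az).symm.eq

theorem comulX_pow (n : ℕ) :
    comulX k p i ^ n = (X ^ n) ⊗ₜ (E₀ * X ^ n) + (A ^ n * Y ^ n) ⊗ₜ (E₁ * X ^ n) := by
  induction n with
  | zero => simp [← TensorProduct.tmul_add, e₀_add_e₁, Algebra.TensorProduct.one_def]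
  | succ n ih =>
    have h0 : X ^ n * E₀ = E₀ * X ^ n := (commute_e₀ (commute_ax.pow_right n)).symm.eq
    have h1 : X ^ n * E₁ = E₁ * X ^ n := (commute_e₁ (commute_ax.pow_right n)).symm.eq
    have h2 : Y ^ n * A = A * Y ^ n := (commute_axinv.pow_right n).symm.eq
    have e00 : E₀ * X ^ n * (E₀ * X) = E₀ * X ^ (n + 1) := by
      rw [mul_assoc, ← mul_assoc (X ^ n), h0, mul_assoc, ← mul_assoc E₀, e₀_e₀, pow_succ]
    have e01 : E₀ * X ^ n * (E₁ * X) = 0 := by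
      rw [mul_assoc, ← mul_assoc (X ^ n), h1, mul_assoc, ← mul_assoc E₀, e₀_e₁, zero_mul]
    have e10 : E₁ * X ^ n * (E₀ * X) = 0 := by
      rw [mul_assoc, ← mul_assoc (X ^ n), h0, mul_assoc, ← mul_assoc E₁, e₁_e₀, zero_mul]
    have e11 : E₁ * X ^ n * (E₁ * X) = E₁ * X ^ (n + 1) := by
      rw [mul_assoc, ← mul_assoc (X ^ n), h1, mul_assoc, ← mul_assoc E₁, e₁_e₁, pow_succ]
    have ax' : A ^ n * Y ^ n * (A * Y) = A ^ (n + 1) * Y ^ (n + 1) := by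
      rw [mul_assoc, ← mul_assoc (Y ^ n), h2, pow_succ, pow_succ]
      simp only [mul_assoc]
    rw [pow_succ, ih, comulX]
    simp only [mul_add, add_mul, Algebra.TensorProduct.tmul_mul_tmul, e00, e01, e10, e11, ax',
      TensorProduct.tmul_zero, add_zero, zero_add, pow_succ]

variable (k p i) in
/-- The comultiplication: `a ↦ a ⊗ a`, `x ↦ x ⊗ e₀x + ax⁻¹ ⊗ e₁x`, `z ↦ g ⊗ z + z ⊗ 1`. -/
def comulHom : H8p k p i →ₐ[k] HH :=
  lift i (A ⊗ₜ A) (comulX k p i) (comulZ k p i)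
    (by simp [sq, aa, Algebra.TensorProduct.one_def])
    (by
      rw [comulX_pow, pow_mul A, a_sq, one_pow, one_mul, xinv_pow_eq (add_zero _), pow_zero, x_pow,
        ← TensorProduct.tmul_add, mul_one, mul_one, e₀_add_e₁, Algebra.TensorProduct.one_def])
    (by
      simp only [comulZ, sq, mul_add, add_mul, Algebra.TensorProduct.tmul_mul_tmul, g_g, zz, z_g,
        one_mul, mul_one, TensorProduct.neg_tmul, TensorProduct.tmul_sub, TensorProduct.sub_tmul,
        Algebra.TensorProduct.one_def]
      abel)
    (by
      have hx : A * (A * Y) = A * Y * A := by rw [mul_assoc, commute_axinv.eq]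
      have h0 : A * (E₀ * X) = E₀ * X * A := by rw [← mul_assoc, a_e₀, mul_assoc, ← ax, ← mul_assoc, e₀_a]
      have h1 : A * (E₁ * X) = E₁ * X * A := by rw [← mul_assoc, a_e₁, mul_assoc, ← ax, ← mul_assoc, e₁_a]
      simp only [comulX, mul_add, add_mul, Algebra.TensorProduct.tmul_mul_tmul, hx, h0, h1, ax])
    (by
      simp only [comulZ, mul_add, add_mul, Algebra.TensorProduct.tmul_mul_tmul, az, commute_ag.eq,
        mul_one, one_mul])
    (by
      have hg : A * Y * G = G * (A * Y) :=
        (commute_ag.mul_left (commute_xg.pow_left _)).eq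
      have hz : A * Y * Z = -(Z * (A * Y)) := by
        rw [← mul_assoc, ← az, mul_assoc, mul_assoc, z_xinv, mul_neg, neg_neg]
      have h0 : E₀ * X * Z = -(Z * (E₀ * X)) := by
        rw [← mul_assoc, z_e₀, mul_assoc, mul_assoc, z_x, mul_neg, neg_neg]
      have h1 : E₁ * X * Z = -(Z * (E₁ * X)) := by
        rw [← mul_assoc, z_e₁, mul_assoc, mul_assoc, z_x, mul_neg, neg_neg]
      simp only [comulX, comulZ, mul_add, add_mul, Algebra.TensorProduct.tmul_mul_tmul, hg, hz, h0,
        h1, xz, commute_xg.eq, mul_one, one_mul, TensorProduct.neg_tmul, TensorProduct.tmul_neg]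
      abel)

variable (k p i) in
/-- The counit: `a ↦ 1`, `x ↦ 1`, `z ↦ 0`. -/
def counitHom : H8p k p i →ₐ[k] k :=
  lift i 1 1 0 (by simp) (by simp) (by simp) (by simp) (by simp) (by simp)

theorem counitHom_a : counitHom k p i A = 1 := by simp [counitHom]
theorem counitHom_x : counitHom k p i X = 1 := by simp [counitHom]
theorem counitHom_z : counitHom k p i Z = 0 := by simp [counitHom]
theorem counitHom_xinv : counitHom k p i Y = 1 := by simp [xinv, counitHom_x]
theorem counitHom_e₀ : counitHom k p i E₀ = 1 := by
  rw [e₀, map_smul, map_add, map_one, counitHom_a, one_add_one_eq_two, smul_eq_mul,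
    inv_mul_cancel₀ two_ne_zero]
theorem counitHom_e₁ : counitHom k p i E₁ = 0 := by simp [e₁, counitHom_a]
theorem counitHom_g : counitHom k p i G = 1 := by
  simp [g, counitHom_e₀, counitHom_e₁, counitHom_x]

theorem comulHom_a : comulHom k p i A = A ⊗ₜ A := by simp [comulHom]
theorem comulHom_x : comulHom k p i X = X ⊗ₜ (E₀ * X) + (A * Y) ⊗ₜ (E₁ * X) := by
  simp [comulHom, comulX]
theorem comulHom_z : comulHom k p i Z = G ⊗ₜ Z + Z ⊗ₜ 1 := by simp [comulHom, comulZ]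
theorem comulHom_x_pow (n : ℕ) : comulHom k p i (X ^ n) =
    (X ^ n) ⊗ₜ (E₀ * X ^ n) + (A ^ n * Y ^ n) ⊗ₜ (E₁ * X ^ n) := by
  rw [map_pow, ← comulX_pow]; simp [comulHom]
theorem comulHom_xinv :
    comulHom k p i Y = Y ⊗ₜ (E₀ * Y) + (A * X) ⊗ₜ (E₁ * Y) := by
  have := hp.out.pos
  rw [xinv, comulHom_x_pow, a_pow_odd odd_two_mul_sub_one,
    xinv_pow_eq (show 2 * p - 1 + 1 = 2 * p by omega), pow_one]
theorem comulHom_e₀ : comulHom k p i E₀ = E₀ ⊗ₜ E₀ + E₁ ⊗ₜ E₁ := by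
  have h : (2 : k) ≠ 0 := two_ne_zero
  have h1 : (1 : HH) = (E₀ + E₁) ⊗ₜ (E₀ + E₁) := by
    rw [e₀_add_e₁, Algebra.TensorProduct.one_def]
  rw [e₀, map_smul, map_add, map_one, comulHom_a, ← e₀, h1, ← e₀_sub_e₁]
  simp only [TensorProduct.tmul_add, TensorProduct.add_tmul, TensorProduct.tmul_sub,
    TensorProduct.sub_tmul]
  rw [inv_smul_eq_iff₀ h, two_smul]
  abel
theorem comulHom_e₁ : comulHom k p i E₁ = E₀ ⊗ₜ E₁ + E₁ ⊗ₜ E₀ := by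
  have h : (2 : k) ≠ 0 := two_ne_zero
  have h1 : (1 : HH) = (E₀ + E₁) ⊗ₜ (E₀ + E₁) := by
    rw [e₀_add_e₁, Algebra.TensorProduct.one_def]
  rw [e₁, map_smul, map_sub, map_one, comulHom_a, ← e₁, h1, ← e₀_sub_e₁]
  simp only [TensorProduct.tmul_add, TensorProduct.add_tmul, TensorProduct.tmul_sub,
    TensorProduct.sub_tmul]
  rw [inv_smul_eq_iff₀ h, two_smul]
  abel
theorem comulHom_g : comulHom k p i G = G ⊗ₜ G := by
  have hi : (i : k) * i = -1 := by rw [← sq, i.2]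
  have hap : A * X ^ p = E₀ * X ^ p - E₁ * X ^ p := by rw [← sub_mul, e₀_sub_e₁]
  rw [g, map_mul, comulHom_x_pow, a_pow_odd hp.out, xinv_pow_eq (two_mul p).symm, map_add, map_smul,
    comulHom_e₀, comulHom_e₁]
  simp only [mul_add, add_mul, Algebra.TensorProduct.tmul_mul_tmul, smul_mul_assoc,
    TensorProduct.tmul_add, TensorProduct.add_tmul, ← mul_assoc, e₀_e₀, e₀_e₁, e₁_e₀, e₁_e₁, e₀_a,
    e₁_a, zero_mul, TensorProduct.tmul_zero, add_zero, zero_add, smul_add,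
    TensorProduct.tmul_smul, TensorProduct.smul_tmul', smul_smul, hi, neg_mul,
    TensorProduct.neg_tmul, neg_smul, one_smul]
  abel

instance instBialgebra : Bialgebra k (H8p k p i) :=
  .ofAlgHom (comulHom k p i) (counitHom k p i)
    (by
      apply hom_ext
      · simp [comulHom_a]
      · simp only [AlgHom.comp_apply, comulHom_x, map_add, map_mul,
          Algebra.TensorProduct.map_tmul, AlgHom.coe_id, id_eq, comulHom_e₀, comulHom_e₁,
          comulHom_a, comulHom_xinv, mul_add, add_mul, Algebra.TensorProduct.tmul_mul_tmul,
          TensorProduct.tmul_add, TensorProduct.add_tmul]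
        simp only [← mul_assoc, e₀_e₀, e₀_e₁, e₁_e₀, e₁_e₁, e₀_a, e₁_a, a_e₀, a_e₁, aa, zero_mul,
          one_mul, TensorProduct.tmul_zero, add_zero, zero_add, neg_mul,
          TensorProduct.neg_tmul, TensorProduct.tmul_neg]
        simp
        abel
      · simp [comulHom_z, comulHom_g, TensorProduct.add_tmul, TensorProduct.tmul_add,
          Algebra.TensorProduct.one_def, add_assoc])
    (by
      apply hom_ext
      · simp [comulHom_a, counitHom_a]
      · simp [comulHom_x, counitHom_a, counitHom_x, counitHom_xinv, ← TensorProduct.tmul_add,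
          ← add_mul, e₀_add_e₁]
      · simp [comulHom_z, counitHom_z, counitHom_g])
    (by
      apply hom_ext
      · simp [comulHom_a, counitHom_a]
      · simp [comulHom_x, counitHom_e₀, counitHom_e₁, counitHom_x]
      · simp [comulHom_z, counitHom_z])

open Coalgebra HopfAlgebra

theorem comul_a : comul (R := k) A = A ⊗ₜ A := comulHom_a
theorem comul_x : comul (R := k) X = X ⊗ₜ (E₀ * X) + (A * Y) ⊗ₜ (E₁ * X) := comulHom_x
theorem comul_z : comul (R := k) Z = G ⊗ₜ Z + Z ⊗ₜ 1 := comulHom_z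
theorem counit_a : counit (R := k) A = 1 := counitHom_a
theorem counit_x : counit (R := k) X = 1 := counitHom_x
theorem counit_z : counit (R := k) Z = 0 := counitHom_z

variable (k p i) in
def antipodeX : H8p k p i := E₀ * Y + A * E₁ * X
variable (k p i) in
def antipodeZ : H8p k p i := -(A * G * Z)

theorem antipodeX_eq : antipodeX k p i = E₀ * Y - E₁ * X := by
  rw [antipodeX, a_e₁, neg_mul, sub_eq_add_neg]

theorem antipodeX_pow (n : ℕ) :
    antipodeX k p i ^ n = E₀ * Y ^ n + (-1) ^ n * (E₁ * X ^ n) := by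
  induction n with
  | zero => simp [e₀_add_e₁]
  | succ n ih =>
    have h0 : X ^ n * E₀ = E₀ * X ^ n := (commute_e₀ (commute_ax.pow_right n)).symm.eq
    have h1 : X ^ n * E₁ = E₁ * X ^ n := (commute_e₁ (commute_ax.pow_right n)).symm.eq
    have h0' : Y ^ n * E₀ = E₀ * Y ^ n := (commute_e₀ (commute_axinv.pow_right n)).symm.eq
    have h1' : Y ^ n * E₁ = E₁ * Y ^ n := (commute_e₁ (commute_axinv.pow_right n)).symm.eq
    have e00 : E₀ * Y ^ n * (E₀ * Y) = E₀ * Y ^ (n + 1) := by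
      rw [mul_assoc, ← mul_assoc (Y ^ n), h0', mul_assoc, ← mul_assoc E₀, e₀_e₀, pow_succ]
    have e01 : E₀ * Y ^ n * (E₁ * X) = 0 := by
      rw [mul_assoc, ← mul_assoc (Y ^ n), h1', mul_assoc, ← mul_assoc E₀, e₀_e₁, zero_mul]
    have e10 : E₁ * X ^ n * (E₀ * Y) = 0 := by
      rw [mul_assoc, ← mul_assoc (X ^ n), h0, mul_assoc, ← mul_assoc E₁, e₁_e₀, zero_mul]
    have e11 : E₁ * X ^ n * (E₁ * X) = E₁ * X ^ (n + 1) := by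
      rw [mul_assoc, ← mul_assoc (X ^ n), h1, mul_assoc, ← mul_assoc E₁, e₁_e₁, pow_succ]
    rw [pow_succ, ih, antipodeX_eq, mul_sub, add_mul, add_mul, mul_assoc ((-1) ^ n),
      mul_assoc ((-1) ^ n), e00, e01, e10, e11, pow_succ (-1)]
    simp [sub_eq_add_neg]

theorem commute_a_antipodeX : Commute A (antipodeX k p i) := by
  have h0 : Commute A E₀ := (commute_e₀ (Commute.refl A)).symm
  have h1 : Commute A E₁ := (commute_e₁ (Commute.refl A)).symm
  rw [antipodeX_eq]
  exact (h0.mul_right commute_axinv).sub_right (h1.mul_right commute_ax)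

theorem commute_g_antipodeX : Commute G (antipodeX k p i) := by
  have h0 : Commute G E₀ := (commute_e₀ commute_ag).symm
  have h1 : Commute G E₁ := (commute_e₁ commute_ag).symm
  have h2 : Commute G X := commute_xg.symm
  rw [antipodeX_eq]
  exact (h0.mul_right (h2.pow_right _)).sub_right (h1.mul_right h2)

theorem z_antipodeX : Z * antipodeX k p i = -(antipodeX k p i * Z) := by
  rw [antipodeX_eq, mul_sub, sub_mul, ← mul_assoc, ← mul_assoc, z_e₀, z_e₁, mul_assoc, mul_assoc,
    z_xinv, z_x]
  simp only [mul_assoc, mul_neg]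
  abel

theorem z_ag : Z * (A * G) = -(A * G * Z) := by
  rw [← mul_assoc, ← az, mul_assoc, z_g, mul_neg, mul_assoc]

theorem ag_ag : A * G * (A * G) = A := by
  rw [mul_assoc, ← mul_assoc G, ← commute_ag.eq, mul_assoc A G, g_g, aa, mul_one]

theorem antipodeZ_sq : antipodeZ k p i ^ 2 = A - 1 := by
  have h : A * G * Z * (A * G * Z) = -(A * G * (A * G) * (Z * Z)) := by
    rw [mul_assoc (A * G) Z, ← mul_assoc Z, z_ag]
    simp only [mul_assoc, mul_neg, neg_mul]
  rw [antipodeZ, neg_sq, sq, h, ag_ag, zz, mul_sub, aa, mul_one, neg_sub]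

theorem antipodeZ_antipodeX :
    antipodeZ k p i * antipodeX k p i = -(antipodeX k p i * antipodeZ k p i) := by
  have h : A * G * antipodeX k p i = antipodeX k p i * (A * G) :=
    (commute_a_antipodeX.mul_left commute_g_antipodeX).eq
  rw [antipodeZ, neg_mul, mul_assoc, z_antipodeX, mul_neg, ← mul_assoc, h, mul_neg, mul_assoc]

theorem commute_a_antipodeZ : Commute A (antipodeZ k p i) :=
  (((Commute.refl A).mul_right commute_ag).mul_right commute_az).neg_right

variable (k p i) in
/-- The antipode, as an algebra map to the opposite algebra: `a ↦ a`,
`x ↦ e₀x⁻¹ + ae₁x`, `z ↦ -g⁻¹z`, where `g⁻¹ = ag`. -/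
def antipodeHom : H8p k p i →ₐ[k] (H8p k p i)ᵐᵒᵖ :=
  lift i (op A) (op (antipodeX k p i)) (op (antipodeZ k p i))
    (by rw [← op_pow, a_sq, op_one])
    (by
      rw [← op_pow, antipodeX_pow, xinv_pow_eq (add_zero _), pow_zero, x_pow,
        (even_two_mul p).neg_one_pow, mul_one, mul_one, one_mul, e₀_add_e₁, op_one])
    (by rw [← op_pow, ← op_one, ← op_sub, antipodeZ_sq])
    (by rw [← op_mul, ← op_mul, commute_a_antipodeX.eq])
    (by rw [← op_mul, ← op_mul, commute_a_antipodeZ.eq])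
    (by rw [← op_mul, ← op_mul, ← op_neg, antipodeZ_antipodeX])

variable (k p i) in
def antipodeMap : H8p k p i →ₗ[k] H8p k p i :=
  (opLinearEquiv k).symm.toLinearMap ∘ₗ (antipodeHom k p i).toLinearMap

theorem antipodeMap_mul (u v : H8p k p i) :
    antipodeMap k p i (u * v) = antipodeMap k p i v * antipodeMap k p i u := by
  simp [antipodeMap]
theorem antipodeMap_one : antipodeMap k p i 1 = 1 := by simp [antipodeMap]
theorem antipodeMap_a : antipodeMap k p i A = A := by simp [antipodeMap, antipodeHom]
theorem antipodeMap_x : antipodeMap k p i X = E₀ * Y + A * E₁ * X := by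
  simp [antipodeMap, antipodeHom, antipodeX]
theorem antipodeMap_z : antipodeMap k p i Z = -(A * G * Z) := by
  simp [antipodeMap, antipodeHom, antipodeZ]
theorem antipodeMap_x_pow (n : ℕ) :
    antipodeMap k p i (X ^ n) = E₀ * Y ^ n + (-1) ^ n * (E₁ * X ^ n) := by
  simp [← antipodeX_pow, antipodeMap, antipodeHom]
theorem antipodeMap_xinv : antipodeMap k p i Y = E₀ * X - E₁ * Y := by
  have := hp.out.pos
  rw [xinv, antipodeMap_x_pow, xinv_pow_eq (show 2 * p - 1 + 1 = 2 * p by omega), pow_one,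
    odd_two_mul_sub_one.neg_one_pow, neg_one_mul, sub_eq_add_neg]
theorem antipodeMap_e₀ : antipodeMap k p i E₀ = E₀ := by
  simp [e₀, antipodeMap_a, antipodeMap_one]
theorem antipodeMap_e₁ : antipodeMap k p i E₁ = E₁ := by
  simp [e₁, antipodeMap_a, antipodeMap_one]
theorem antipodeMap_g : antipodeMap k p i G = A * G := by
  have h0 : Commute (X ^ p) E₀ := (commute_e₀ (commute_ax.pow_right p)).symm
  have h1 : Commute (X ^ p) E₁ := (commute_e₁ (commute_ax.pow_right p)).symm
  rw [g, antipodeMap_mul, antipodeMap_x_pow, xinv_pow_eq (two_mul p).symm, map_add, map_smul,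
    antipodeMap_e₀, antipodeMap_e₁, hp.out.neg_one_pow, neg_one_mul, ← sub_eq_add_neg, ← sub_mul,
    e₀_sub_e₁, mul_assoc, (h0.add_right (h1.smul_right _)).eq]

theorem antipode_left (h : H8p k p i) :
    LinearMap.mul' k _ ((antipodeMap k p i).rTensor _ (comul (R := k) h)) =
      algebraMap k _ (counit (R := k) h) := by
  have key : ∀ (s t : HH) (r : k),
      LinearMap.mul' k _ ((antipodeMap k p i).rTensor _ s) = algebraMap k _ r →
      LinearMap.mul' k _ ((antipodeMap k p i).rTensor _ (s * t)) =
        r • LinearMap.mul' k _ ((antipodeMap k p i).rTensor _ t) := by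
    intro s t r hr
    induction t with
    | zero => simp
    | add t t' ht ht' => simp only [mul_add, map_add, ht, ht', smul_add]
    | tmul c d =>
      have h1 : ∀ s : HH, LinearMap.mul' k _ ((antipodeMap k p i).rTensor _ (s * c ⊗ₜ d)) =
          antipodeMap k p i c * LinearMap.mul' k _ ((antipodeMap k p i).rTensor _ s) * d := by
        intro s
        induction s with
        | zero => simp
        | add s s' hs hs' => simp only [add_mul, mul_add, map_add, hs, hs']
        | tmul u v => simp [antipodeMap_mul, mul_assoc]
      rw [h1, hr, ← Algebra.commutes, ← Algebra.smul_def]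
      simp
  induction h using induction with
  | halg r =>
    simp [Algebra.algebraMap_eq_smul_one, Algebra.TensorProduct.one_def, antipodeMap_one]
  | ha => simp [comul_a, counit_a, antipodeMap_a, aa]
  | hx =>
    have h1 : E₀ * Y * (E₀ * X) = E₀ := by
      rw [mul_assoc, ← mul_assoc Y, ← (commute_e₀ commute_axinv).eq, mul_assoc, xinv_x, mul_one,
        e₀_e₀]
    have h2 : A * E₁ * X * (E₀ * X) = 0 := by
      rw [mul_assoc, ← mul_assoc X, x_e₀, mul_assoc A, ← mul_assoc E₁, ← mul_assoc E₁, e₁_e₀]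
      simp
    have h3 : (E₀ * X - E₁ * Y) * A * (E₁ * X) = E₁ := by
      have h4 : (E₀ * X - E₁ * Y) * A * (E₁ * X) = -((E₀ * X - E₁ * Y) * (E₁ * X)) := by
        rw [mul_assoc, ← mul_assoc A, a_e₁, neg_mul, mul_neg]
      have h5 : E₀ * X * (E₁ * X) = 0 := by
        rw [mul_assoc, ← mul_assoc X, x_e₁, mul_assoc, ← mul_assoc, e₀_e₁, zero_mul]
      have h6 : E₁ * Y * (E₁ * X) = E₁ := by
        rw [mul_assoc, ← mul_assoc Y, ← (commute_e₁ commute_axinv).eq, mul_assoc, xinv_x, mul_one,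
          e₁_e₁]
      rw [h4, sub_mul, h5, h6, zero_sub, neg_neg]
    simp only [comul_x, counit_x, map_add, LinearMap.rTensor_tmul, LinearMap.mul'_apply,
      antipodeMap_mul, antipodeMap_x, antipodeMap_xinv, antipodeMap_a, add_mul, h1, h2, h3, map_one,
      add_zero, e₀_add_e₁]
  | hz => simp [comul_z, counit_z, antipodeMap_g, antipodeMap_z]
  | hadd u v hu hv => simp only [map_add, hu, hv]
  | hmul u v hu hv =>
    rw [Bialgebra.comul_mul, key _ _ _ hu, hv, Bialgebra.counit_mul, map_mul, Algebra.smul_def]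

theorem antipode_right (h : H8p k p i) :
    LinearMap.mul' k _ ((antipodeMap k p i).lTensor _ (comul (R := k) h)) =
      algebraMap k _ (counit (R := k) h) := by
  have key : ∀ (s t : HH) (r : k),
      LinearMap.mul' k _ ((antipodeMap k p i).lTensor _ t) = algebraMap k _ r →
      LinearMap.mul' k _ ((antipodeMap k p i).lTensor _ (s * t)) =
        r • LinearMap.mul' k _ ((antipodeMap k p i).lTensor _ s) := by
    intro s t r hr
    induction s with
    | zero => simp
    | add t t' ht ht' => simp only [add_mul, map_add, ht, ht', smul_add]
    | tmul c d =>
      have h1 : ∀ t : HH, LinearMap.mul' k _ ((antipodeMap k p i).lTensor _ (c ⊗ₜ d * t)) =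
          c * LinearMap.mul' k _ ((antipodeMap k p i).lTensor _ t) * antipodeMap k p i d := by
        intro s
        induction s with
        | zero => simp
        | add s s' hs hs' => simp only [add_mul, mul_add, map_add, hs, hs']
        | tmul u v => simp [antipodeMap_mul, mul_assoc]
      rw [h1, hr, ← Algebra.commutes, mul_assoc, ← Algebra.smul_def]
      simp
  induction h using induction with
  | halg r =>
    simp [Algebra.algebraMap_eq_smul_one, Algebra.TensorProduct.one_def, antipodeMap_one]
  | ha => simp [comul_a, counit_a, antipodeMap_a, aa]
  | hx =>
    have h0 : Commute E₀ X := commute_e₀ commute_ax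
    have h0' : Commute E₀ Y := commute_e₀ commute_axinv
    have h1 : Commute E₁ X := commute_e₁ commute_ax
    have h1' : Commute E₁ Y := commute_e₁ commute_axinv
    have s0 : (E₀ * Y + A * E₁ * X) * E₀ = Y * E₀ := by
      rw [add_mul, mul_assoc, ← h0'.eq, ← mul_assoc, e₀_e₀, mul_assoc (A * E₁), ← h0.eq,
        mul_assoc A, ← mul_assoc E₁, e₁_e₀, zero_mul, mul_zero, add_zero]
    have s1 : (E₀ * Y + A * E₁ * X) * E₁ = A * (X * E₁) := by
      rw [add_mul, mul_assoc, ← h1'.eq, ← mul_assoc, e₀_e₁, zero_mul, zero_add, mul_assoc (A * E₁),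
        ← h1.eq, mul_assoc A, ← mul_assoc E₁, e₁_e₁]
    have t1 : A * Y * (A * (X * E₁)) = E₁ := by
      rw [← mul_assoc, mul_assoc A, ← commute_axinv.eq, ← mul_assoc A, aa, one_mul, ← mul_assoc,
        xinv_x, one_mul]
    have t0 : X * (Y * E₀) = E₀ := by rw [← mul_assoc, x_xinv, one_mul]
    simp only [comul_x, counit_x, map_add, LinearMap.lTensor_tmul, LinearMap.mul'_apply,
      antipodeMap_mul, antipodeMap_x, antipodeMap_e₀, antipodeMap_e₁, s0, s1, t0, t1, map_one,
      e₀_add_e₁]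
  | hz =>
    have h : G * (A * G * Z) = Z := by
      rw [← mul_assoc, ← mul_assoc, ← commute_ag.eq, mul_assoc A, g_g, aa, one_mul]
    simp [comul_z, counit_z, antipodeMap_z, antipodeMap_one, h]
  | hadd u v hu hv => simp only [map_add, hu, hv]
  | hmul u v hu hv => rw [Bialgebra.comul_mul, key _ _ _ hv, hu, Bialgebra.counit_mul, map_mul,
      Algebra.smul_def, Algebra.commutes]

instance instHopfAlgebra : HopfAlgebra k (H8p k p i) where
  antipode := antipodeMap k p i
  mul_antipode_rTensor_comul := LinearMap.ext antipode_left
  mul_antipode_lTensor_comul := LinearMap.ext antipode_right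

theorem antipode_a : antipode k A = A := antipodeMap_a
theorem antipode_x : antipode k X = E₀ * Y + A * E₁ * X := antipodeMap_x
theorem antipode_z : antipode k Z = -(A * G * Z) := antipodeMap_z
theorem g_mul_ag : G * (A * G) = 1 := by rw [← mul_assoc, ← commute_ag.eq, mul_assoc, g_g, aa]

end Odd

end Alg
end H8p

end

/-! Let B be the commutative subalgebra generated by a and x, so that H = B ⊕ Bz, and fix a
primitive character ψ of ℤ/2p. The Fourier transform along ψ turns the elements e₀x^m and e₁x^m into
4p orthogonal idempotents of B with sum 1. Their comultiplication (`comul_idem`) is dual to the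
multiplication of the dicyclic group, which appears as `QuaternionGroup p`; hence B is a copy of its
function algebra. The two-dimensional representations `dicRep`, in which a acts by 1 or -1, separate
the products of these idempotents with 1 and z. This gives a basis and the dimension 8p.

Coradical of H: since g ∈ B, one has Δ(B) ⊆ B ⊗ B and Δ(Bz) ⊆ B ⊗ Bz + Bz ⊗ B, so `coradical_le`
bounds the coradical by B. Conversely, if m ≠ -m then e₀x^m, e₁x^m lie in a 2×2 comatrix block
together with e₀x^{-m}, e₁x^{-m}; if m = -m they are combinations of two group-like elements. So all
of B lies in the coradical, and the block of m = 1 is not cocommutative, which excludes pointedness.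

Coradical of the dual: z² = a - 1 is 0 on the e₀ part and -2 on the e₁ part. Hence w = e₀z is a
nonzero normal element of square zero. This excludes semisimplicity, and by `coradical_le_of_normal`
the functionals vanishing on Hw contain the coradical of H^*. On the e₁ part z is invertible and
exchanges the eigenvalues ψ(j) and -ψ(j) of x, so this part is a product of p algebras of 2×2
matrices; any one of them shows that H is not basic. The e₀ part modulo w gives 2p characters.
Dually there are 2p group-like elements and p simple coalgebras of dimension 4, independent and
inside the coradical. Their total dimension 6p is also an upper bound for the space of functionals
vanishing on Hw (`finrank_radicalPerp_le`), so the three spaces coincide. -/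

noncomputable section

/-! ### Slicing tensors by functionals -/

section Slices
open Module
variable {k C D : Type*} [Field k] [AddCommGroup C] [Module k C] [AddCommGroup D] [Module k D]

/-- `f ⊗ id`, as a map `C ⊗ D → D`. -/
def sliceLeft (f : Dual k C) : C ⊗[k] D →ₗ[k] D :=
  (TensorProduct.lid k D).toLinearMap ∘ₗ f.rTensor D

/-- `id ⊗ f`, as a map `C ⊗ D → C`. -/
def sliceRight (f : Dual k D) : C ⊗[k] D →ₗ[k] C :=
  (TensorProduct.rid k C).toLinearMap ∘ₗ f.lTensor C

@[simp] theorem sliceLeft_tmul (f : Dual k C) (c : C) (d : D) :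
    sliceLeft f (c ⊗ₜ[k] d) = f c • d := by simp [sliceLeft]

@[simp] theorem sliceRight_tmul (f : Dual k D) (c : C) (d : D) :
    sliceRight f (c ⊗ₜ[k] d) = f d • c := by simp [sliceRight]

theorem ext_sliceLeft {s t : C ⊗[k] D} (h : ∀ f : Dual k C, sliceLeft f s = sliceLeft f t) :
    s = t := by
  classical
  let b := Basis.ofVectorSpace k C
  apply (TensorProduct.equivFinsuppOfBasisLeft (N := D) b).injective
  have key : ∀ (u : C ⊗[k] D) j,
      TensorProduct.equivFinsuppOfBasisLeft b u j = sliceLeft (b.coord j) u := by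
    intro u j
    induction u with
    | zero => simp
    | add u v hu hv => simp [hu, hv]
    | tmul c d => simp
  ext1 j
  rw [key, key, h]

theorem ext_sliceRight {s t : C ⊗[k] D} (h : ∀ f : Dual k D, sliceRight f s = sliceRight f t) :
    s = t := by
  classical
  let b := Basis.ofVectorSpace k D
  apply (TensorProduct.equivFinsuppOfBasisRight (M := C) b).injective
  have key : ∀ (u : C ⊗[k] D) j,
      TensorProduct.equivFinsuppOfBasisRight b u j = sliceRight (b.coord j) u := by
    intro u j
    induction u with
    | zero => simp
    | add u v hu hv => simp [hu, hv]
    | tmul c d => simp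
  ext1 j
  rw [key, key, h]

theorem sliceLeft_lTensor (f : Dual k C) (q : D →ₗ[k] D) (t : C ⊗[k] D) :
    sliceLeft f (q.lTensor C t) = q (sliceLeft f t) := by
  induction t with
  | zero => simp
  | add s t hs ht => simp [hs, ht]
  | tmul c d => simp

theorem sliceRight_rTensor (f : Dual k D) (q : C →ₗ[k] C) (t : C ⊗[k] D) :
    sliceRight f (q.rTensor D t) = q (sliceRight f t) := by
  induction t with
  | zero => simp
  | add s t hs ht => simp [hs, ht]
  | tmul c d => simp

end Slices

/-! ### Subcoalgebras, simple subcoalgebras and the coradical -/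

section CoalgebraTheory
open Module Coalgebra
variable {k C : Type*} [Field k] [AddCommGroup C] [Module k C] [Coalgebra k C]

/-- Over a field V is the image of a linear projector Q of C. If all slices of Δ(c) lie in V, then
Δ(c) is fixed by id ⊗ Q and by Q ⊗ id, hence by Q ⊗ Q, and so it comes from V ⊗ V. In this form the
condition is visibly stable under intersection. -/
theorem isSubcoalgebra_iff {V : Submodule k C} :
    IsSubcoalgebra k V ↔ ∀ c ∈ V, ∀ f : Dual k C,
      sliceLeft f (comul (R := k) c) ∈ V ∧ sliceRight f (comul (R := k) c) ∈ V := by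
  constructor
  · intro h c hc f
    obtain ⟨t, ht⟩ := h (Submodule.mem_map_of_mem hc)
    rw [← ht]
    clear ht
    induction t with
    | zero => simp
    | add s t hs ht =>
      simp only [map_add]
      exact ⟨V.add_mem hs.1 ht.1, V.add_mem hs.2 ht.2⟩
    | tmul u v =>
      simp only [TensorProduct.map_tmul, sliceLeft_tmul, sliceRight_tmul]
      exact ⟨V.smul_mem _ v.2, V.smul_mem _ u.2⟩
  · rintro h _ ⟨c, hc, rfl⟩
    obtain ⟨P, hP⟩ := LinearMap.exists_leftInverse_of_injective V.subtype V.ker_subtype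
    have hQ : ∀ v ∈ V, (V.subtype ∘ₗ P) v = v := fun v hv =>
      congrArg Subtype.val (LinearMap.congr_fun hP ⟨v, hv⟩)
    have h1 : (V.subtype ∘ₗ P).lTensor C (comul (R := k) c) = comul (R := k) c :=
      ext_sliceLeft fun f => by rw [sliceLeft_lTensor, hQ _ (h c hc f).1]
    have h2 : (V.subtype ∘ₗ P).rTensor C (comul (R := k) c) = comul (R := k) c :=
      ext_sliceRight fun f => by rw [sliceRight_rTensor, hQ _ (h c hc f).2]
    refine ⟨TensorProduct.map P P (comul (R := k) c), ?_⟩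
    rw [← LinearMap.comp_apply, ← TensorProduct.map_comp]
    conv_rhs => rw [← h2, ← h1]
    exact (LinearMap.congr_fun (LinearMap.rTensor_comp_lTensor C (V.subtype ∘ₗ P) (V.subtype ∘ₗ P)) _).symm

theorem IsSubcoalgebra.inf {V W : Submodule k C} (hV : IsSubcoalgebra k V)
    (hW : IsSubcoalgebra k W) : IsSubcoalgebra k (V ⊓ W) := by
  rw [isSubcoalgebra_iff] at *
  exact fun c hc f =>
    ⟨⟨(hV c hc.1 f).1, (hW c hc.2 f).1⟩, ⟨(hV c hc.1 f).2, (hW c hc.2 f).2⟩⟩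

theorem counit_sliceLeft_comul (f : Dual k C) (c : C) :
    counit (R := k) (sliceLeft f (comul (R := k) c)) = f c := by
  have h : ∀ t : C ⊗[k] C, counit (R := k) (sliceLeft f t) =
      f (TensorProduct.rid k C ((counit (R := k)).lTensor C t)) := by
    intro t
    induction t with
    | zero => simp
    | add s t hs ht => simp [hs, ht]
    | tmul c d => simp [mul_comm]
  rw [h, lTensor_counit_comul]
  simp

/-- A subcoalgebra `D` with `Δ(C) ⊆ D ⊗ C + C ⊗ D` contains the coradical. -/
theorem coradical_le {D : Submodule k C} (hD : IsSubcoalgebra k D)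
    (h : ∀ f : Dual k C, (∀ d ∈ D, f d = 0) → ∀ c, sliceLeft f (comul (R := k) c) ∈ D) :
    coradical k C ≤ D := by
  refine sSup_le fun V hV => ?_
  by_contra hVD
  obtain ⟨v, hvV, hvD⟩ := Set.not_subset.1 hVD
  obtain ⟨f, hfv, hf⟩ := Submodule.exists_dual_map_eq_bot_of_notMem hvD inferInstance
  have hf' : ∀ d ∈ D, f d = 0 := fun d hd =>
    (Submodule.eq_bot_iff _).1 hf _ (Submodule.mem_map_of_mem hd)
  -- The slice is in V because V is a subcoalgebra and in D because f kills D. Its counit is f v ≠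
  -- 0, so V ⊓ D is not zero; by simplicity it is V, against the choice of v outside D.
  have hmem : sliceLeft f (comul (R := k) v) ∈ V ⊓ D :=
    ⟨(isSubcoalgebra_iff.1 hV.isSubcoalgebra v hvV f).1, h f hf' v⟩
  rcases hV.eq_bot_or_eq _ (hV.isSubcoalgebra.inf hD) inf_le_left with h0 | h0
  · rw [h0, Submodule.mem_bot] at hmem
    apply hfv
    rw [← counit_sliceLeft_comul, hmem, map_zero]
  · exact hvD (inf_eq_left.1 h0 hvV)

/-- Comatrix elements `c` with dual functionals `f` span a simple subcoalgebra. -/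
theorem isSimpleSubcoalgebra_of_comatrix {n : Type*} [Fintype n] [DecidableEq n] [Nonempty n]
    (c : n → n → C) (hc : ∀ i j, comul (R := k) (c i j) = ∑ l, c i l ⊗ₜ[k] c l j)
    (f : n → n → Dual k C)
    (hf : ∀ i j l m, f i j (c l m) = if i = l ∧ j = m then 1 else 0) :
    IsSimpleSubcoalgebra k (Submodule.span k (Set.range fun t : n × n => c t.1 t.2)) := by
  have mem : ∀ i j, c i j ∈ Submodule.span k (Set.range fun t : n × n => c t.1 t.2) :=
    fun i j => Submodule.subset_span ⟨(i, j), rfl⟩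
  have expand : ∀ w ∈ Submodule.span k (Set.range fun t : n × n => c t.1 t.2),
      w = ∑ i, ∑ j, f i j w • c i j := by
    intro w hw
    induction hw using Submodule.span_induction with
    | mem w hw =>
      obtain ⟨⟨a, b⟩, rfl⟩ := hw
      simp [hf, ite_and]
    | zero => simp
    | add u v _ _ hu hv =>
      simp only [map_add, add_smul, Finset.sum_add_distrib]
      rw [← hu, ← hv]
    | smul r u _ hu =>
      simp only [map_smul, smul_assoc, ← Finset.smul_sum]
      rw [← hu]
  refine ⟨?_, ?_, ?_⟩
  · rw [isSubcoalgebra_iff]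
    intro w hw g
    induction hw using Submodule.span_induction with
    | mem w hw =>
      obtain ⟨⟨a, b⟩, rfl⟩ := hw
      simp only [hc, map_sum, sliceLeft_tmul, sliceRight_tmul]
      exact ⟨Submodule.sum_mem _ fun l _ => Submodule.smul_mem _ _ (mem _ _),
        Submodule.sum_mem _ fun l _ => Submodule.smul_mem _ _ (mem _ _)⟩
    | zero => simp
    | add u v _ _ hu hv =>
      simp only [map_add]
      exact ⟨Submodule.add_mem _ hu.1 hv.1, Submodule.add_mem _ hu.2 hv.2⟩
    | smul r u _ hu =>
      simp only [map_smul]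
      exact ⟨Submodule.smul_mem _ _ hu.1, Submodule.smul_mem _ _ hu.2⟩
  · intro h
    obtain ⟨a⟩ := ‹Nonempty n›
    have h0 : c a a = 0 := by simpa [h] using mem a a
    have h1 := hf a a a a
    simp [h0] at h1
  · intro W hW hle
    rw [isSubcoalgebra_iff] at hW
    refine or_iff_not_imp_left.2 fun hne => le_antisymm hle (Submodule.span_le.2 ?_)
    rintro _ ⟨⟨a, b⟩, rfl⟩
    obtain ⟨w, hw, hw0⟩ := Submodule.exists_mem_ne_zero_of_ne_bot hne
    obtain ⟨s, t, hst⟩ : ∃ s t, f s t w ≠ 0 := by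
      by_contra! hcon
      apply hw0
      rw [expand w (hle hw)]
      simp [hcon]
    -- Slicing on the left by the functional dual to c s a and on the right by the one dual to c b t
    -- moves the coefficient of c s t in w onto c a b and kills all other terms. So one nonzero
    -- coefficient produces every comatrix element inside W.
    have h1 := (hW _ (hW w hw (f s a)).1 (f b t)).2
    have h2 : sliceRight (f b t) (comul (R := k) (sliceLeft (f s a) (comul (R := k) w))) =
        f s t w • c a b := by
      conv_lhs => rw [expand w (hle hw)]
      simp [hc, hf, ite_and, Finset.sum_ite_eq]
    rw [h2] at h1
    simpa [hst] using W.smul_mem (f s t w)⁻¹ h1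

/-- A group-like element is a 1×1 comatrix, with the counit as dual functional. -/
theorem isSimpleSubcoalgebra_of_isGroupLikeElem {c : C} (hc : IsGroupLikeElem k c) :
    IsSimpleSubcoalgebra k (Submodule.span k {c}) := by
  have h := isSimpleSubcoalgebra_of_comatrix (k := k) (n := Unit) (fun _ _ => c)
    (by simp [hc.comul_eq_tmul_self]) (fun _ _ => counit) (by simp [hc.counit_eq_one])
  simpa [Set.range_const] using h

theorem IsSimpleSubcoalgebra.le_coradical {V : Submodule k C} (h : IsSimpleSubcoalgebra k V) :
    V ≤ coradical k C := le_sSup h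

/-- The linear span of group-like elements is cocommutative. -/
theorem comm_comul_of_mem_span_isGroupLikeElem {c : C}
    (hc : c ∈ Submodule.span k {c : C | IsGroupLikeElem k c}) :
    TensorProduct.comm k C C (comul (R := k) c) = comul (R := k) c := by
  induction hc using Submodule.span_induction with
  | mem c hc => rw [IsGroupLikeElem.comul_eq_tmul_self hc]; simp
  | zero => simp
  | add u v _ _ hu hv => simp [hu, hv]
  | smul r u _ hu => simp [hu]

end CoalgebraTheory

/-! ### Coalgebra maps dual to algebra maps -/

section DualMap
open Module Coalgebra
variable {k A B : Type*} [Field k] [Ring A] [Algebra k A] [Module.Finite k A]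
  [Ring B] [Algebra k B] [Module.Finite k B]

namespace LinDual

/-- The coalgebra map `B^* → A^*` dual to an algebra map `A → B`. -/
def coalgMap (ρ : A →ₐ[k] B) : LinDual k B →ₗc[k] LinDual k A where
  toFun f := (toDual k A).symm (toDual k B f ∘ₗ ρ.toLinearMap)
  map_add' _ _ := rfl
  map_smul' _ _ := rfl
  counit_comp := by
    refine LinearMap.ext fun f => ?_
    change f (ρ 1) = f 1
    rw [map_one]
  map_comp_comul := by
    refine LinearMap.ext fun f => pairing_ext fun x y => ?_
    have h : ∀ (q : LinDual k B →ₗ[k] LinDual k A) (_ : ∀ f x, q f x = f (ρ x))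
        (t : LinDual k B ⊗[k] LinDual k B),
        pairing k A (TensorProduct.map q q t) (x ⊗ₜ y) = pairing k B t (ρ x ⊗ₜ ρ y) := by
      intro q hq t
      induction t with
      | zero => simp
      | add s t hs ht => simp [hs, ht]
      | tmul f g => simp [hq]
    rw [LinearMap.comp_apply, h _ (fun _ _ => rfl), LinearMap.comp_apply, pairing_comul,
      pairing_comul, ← map_mul]
    rfl

@[simp] theorem coalgMap_apply (ρ : A →ₐ[k] B) (f : LinDual k B) (x : A) :
    coalgMap ρ f x = f (ρ x) := rfl

/-- Algebra maps `A → k` are group-like in `A^*`. -/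
theorem isGroupLikeElem_of_algHom (χ : A →ₐ[k] k) :
    IsGroupLikeElem k ((toDual k A).symm χ.toLinearMap) where
  counit_eq_one := by simp
  comul_eq_tmul_self := pairing_ext fun x y => by simp

end LinDual
end DualMap

/-! ### The coradical of the dual of a finite-dimensional algebra -/

section LinDualSlices
open Module Coalgebra LinDual
variable {k A : Type*} [Field k] [Ring A] [Algebra k A] [Module.Finite k A]

namespace LinDual

theorem sliceLeft_apply (F : Dual k (LinDual k A)) (u : A) (hF : ∀ f, F f = f u)
    (t : LinDual k A ⊗[k] LinDual k A) (y : A) : sliceLeft F t y = pairing k A t (u ⊗ₜ y) := by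
  induction t with
  | zero => simp
  | add s t hs ht => simp [hs, ht]
  | tmul f g => simp [hF]

theorem sliceRight_apply (F : Dual k (LinDual k A)) (u : A) (hF : ∀ f, F f = f u)
    (t : LinDual k A ⊗[k] LinDual k A) (y : A) : sliceRight F t y = pairing k A t (y ⊗ₜ u) := by
  induction t with
  | zero => simp
  | add s t hs ht => simp [hs, ht]
  | tmul f g => simp [hF, mul_comm]

/-- Reflexivity of the finite-dimensional space A. It turns slices of the dual comultiplication into
translations f ↦ f(u ·) and f ↦ f(· u). -/
theorem exists_eq_eval (F : Dual k (LinDual k A)) : ∃ u : A, ∀ f, F f = f u := by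
  obtain ⟨u, hu⟩ := (Module.evalEquiv k A).surjective (F ∘ₗ (toDual k A).symm.toLinearMap)
  exact ⟨u, fun f => (LinearMap.congr_fun hu (toDual k A f)).symm⟩

/-- The functionals vanishing on an ideal of square zero, given by a normal element `w`, contain
the coradical of the dual coalgebra. -/
theorem coradical_le_of_normal {w : A} (hw : ∀ h, ∃ h', w * h = h' * w) (hw2 : w * w = 0)
    {V : Submodule k (LinDual k A)} (hV : ∀ f, f ∈ V ↔ ∀ h, f (h * w) = 0) :
    coradical k (LinDual k A) ≤ V := by
  apply coradical_le
  · rw [isSubcoalgebra_iff]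
    intro f hf F
    obtain ⟨u, hu⟩ := exists_eq_eval F
    rw [hV] at hf
    simp only [hV, sliceLeft_apply F u hu, sliceRight_apply F u hu, pairing_comul]
    refine ⟨fun h => by rw [← mul_assoc, hf], fun h => ?_⟩
    obtain ⟨h', hh⟩ := hw u
    rw [mul_assoc, hh, ← mul_assoc, hf]
  · intro F hF f
    obtain ⟨u, hu⟩ := exists_eq_eval F
    -- Double annihilator: the functional F kills every f that vanishes on Aw, so the point u at
    -- which it evaluates lies in Aw.
    obtain ⟨h, rfl⟩ : u ∈ LinearMap.range (LinearMap.mulRight k w) := by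
      by_contra hcon
      obtain ⟨g, hgu, hg⟩ := Submodule.exists_dual_map_eq_bot_of_notMem hcon inferInstance
      refine hgu ((hu ((toDual k A).symm g)).symm.trans (hF _ ((hV _).2 fun h => ?_)))
      exact (Submodule.eq_bot_iff _).1 hg _ (Submodule.mem_map_of_mem ⟨h, rfl⟩)
    rw [hV]
    intro h2
    -- With u = hw, the product u h₂ w equals h h' w², which is zero.
    obtain ⟨h', hh⟩ := hw h2
    rw [sliceLeft_apply F _ hu, pairing_comul, LinearMap.mulRight_apply, mul_assoc, ← mul_assoc w,
      hh, mul_assoc, hw2, mul_zero, mul_zero, map_zero]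

variable {n : Type*} [Fintype n] [DecidableEq n]

variable (k) in
/-- The matrix entries, as elements of the dual of the matrix algebra. -/
def entry (l m : n) : LinDual k (Matrix n n k) :=
  (toDual k _).symm (Matrix.entryLinearMap k k l m)

@[simp] theorem entry_apply (l m : n) (M : Matrix n n k) : entry k l m M = M l m := rfl

theorem comul_entry (l m : n) :
    comul (R := k) (entry k l m) = ∑ j, entry k l j ⊗ₜ[k] entry k j m := by
  apply pairing_ext
  intro x y
  simp [Matrix.mul_apply]

theorem apply_eq_sum (f : LinDual k (Matrix n n k)) (M : Matrix n n k) :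
    f M = ∑ l, ∑ m, M l m * f (Matrix.single l m 1) := by
  conv_lhs => rw [Matrix.matrix_eq_sum_single M]
  simp only [map_sum]
  refine Finset.sum_congr rfl fun l _ => Finset.sum_congr rfl fun m _ => ?_
  rw [← smul_eq_mul, ← map_smul, Matrix.smul_single, smul_eq_mul, mul_one]

theorem eq_sum_entry (f : LinDual k (Matrix n n k)) :
    f = ∑ l, ∑ m, f (Matrix.single l m 1) • entry k l m := by
  have h : ∀ (s : Finset n) (g : n → LinDual k (Matrix n n k)) M, (∑ l ∈ s, g l) M = ∑ l ∈ s, g l M :=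
    fun s g M => LinearMap.sum_apply s g M
  ext M
  rw [apply_eq_sum]
  simp [h, mul_comm]

/-- The matrix coalgebra maps into the coradical. -/
theorem coalgMap_mem_coradical [Nonempty n] (ρ : A →ₐ[k] Matrix n n k) (u : n → n → A)
    (hu : ∀ l m, ρ (u l m) = Matrix.single l m 1) (f : LinDual k (Matrix n n k)) :
    coalgMap ρ f ∈ coradical k (LinDual k A) := by
  have h := isSimpleSubcoalgebra_of_comatrix (k := k) (fun l m => coalgMap ρ (entry k l m))
    (by
      intro l m
      rw [← CoalgHomClass.map_comp_comul_apply, comul_entry]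
      simp)
    -- Evaluation at a preimage of a matrix unit is dual to the pulled back matrix entries.
    (fun l m => Dual.eval k A (u l m) ∘ₗ (toDual k A).toLinearMap)
    (by
      intro a b l m
      change (ρ (u a b)) l m = _
      simp [hu, Matrix.single_apply])
  rw [eq_sum_entry f]
  simp only [map_sum, map_smul]
  exact Submodule.sum_mem _ fun l _ => Submodule.sum_mem _ fun m _ => Submodule.smul_mem _ _
    (h.le_coradical (Submodule.subset_span ⟨(l, m), rfl⟩))

end LinDual

/-! ### Coalgebra maps out of a direct sum -/

theorem LinearMap.lsum_comp_single {ι E : Type*} {D : ι → Type*} [Fintype ι] [DecidableEq ι]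
    [AddCommGroup E] [Module k E] [∀ j, AddCommGroup (D j)] [∀ j, Module k (D j)]
    (g : ∀ j, D j →ₗ[k] E) (j : ι) : LinearMap.lsum k D k g ∘ₗ LinearMap.single k D j = g j := by
  ext d
  exact LinearMap.lsum_piSingle (S := k) (f := g) (i := j) (x := d)

/-- The coalgebra map out of a finite direct sum of coalgebras. -/
def CoalgHom.prodPiDesc {ι C E : Type*} {D : ι → Type*} [Fintype ι] [DecidableEq ι]
    [AddCommGroup C] [Module k C] [Coalgebra k C] [AddCommGroup E] [Module k E] [Coalgebra k E]
    [∀ j, AddCommGroup (D j)] [∀ j, Module k (D j)] [∀ j, Coalgebra k (D j)]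
    (f : C →ₗc[k] E) (g : ∀ j, D j →ₗc[k] E) : (C × ∀ j, D j) →ₗc[k] E where
  __ := LinearMap.coprod f.toLinearMap (LinearMap.lsum k D k fun j => (g j).toLinearMap)
  counit_comp := by
    apply LinearMap.prod_ext
    · rw [LinearMap.comp_assoc, LinearMap.coprod_inl, Prod.counit_comp_inl, f.counit_comp]
    · apply LinearMap.pi_ext'
      intro j
      change _ ∘ₗ ((LinearMap.coprod _ _) ∘ₗ LinearMap.inr k C (∀ j, D j)) ∘ₗ
        LinearMap.single k D j = _
      rw [LinearMap.coprod_inr, LinearMap.lsum_comp_single, (g j).counit_comp,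
        Prod.counit_comp_inr, Pi.counit_comp_single]
  map_comp_comul := by
    apply LinearMap.prod_ext
    · rw [LinearMap.comp_assoc, Prod.comul_comp_inl, ← LinearMap.comp_assoc,
        ← TensorProduct.map_comp, LinearMap.comp_assoc, LinearMap.coprod_inl, f.map_comp_comul]
    · apply LinearMap.pi_ext'
      intro j
      -- Compatibility with Δ is checked on each summand: the inclusion of the j-th one is itself
      -- compatible with Δ (`hc`), and followed by the map it gives g j.
      have hT : (LinearMap.coprod f.toLinearMap (LinearMap.lsum k D k fun j => (g j).toLinearMap)) ∘ₗ
          (LinearMap.inr k C (∀ j, D j) ∘ₗ LinearMap.single k D j) = (g j).toLinearMap := by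
        rw [← LinearMap.comp_assoc, LinearMap.coprod_inr, LinearMap.lsum_comp_single]
      have hc : comul (R := k) ∘ₗ (LinearMap.inr k C (∀ j, D j) ∘ₗ LinearMap.single k D j) =
          TensorProduct.map (LinearMap.inr k C (∀ j, D j) ∘ₗ LinearMap.single k D j)
            (LinearMap.inr k C (∀ j, D j) ∘ₗ LinearMap.single k D j) ∘ₗ comul := by
        rw [← LinearMap.comp_assoc, Prod.comul_comp_inr, LinearMap.comp_assoc,
          Pi.comul_comp_single, ← LinearMap.comp_assoc, ← TensorProduct.map_comp]
      simp only [LinearMap.comp_assoc]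
      rw [hc, hT, ← LinearMap.comp_assoc, ← TensorProduct.map_comp, hT, (g j).map_comp_comul]

theorem CoalgHom.prodPiDesc_apply {ι C E : Type*} {D : ι → Type*} [Fintype ι] [DecidableEq ι]
    [AddCommGroup C] [Module k C] [Coalgebra k C] [AddCommGroup E] [Module k E] [Coalgebra k E]
    [∀ j, AddCommGroup (D j)] [∀ j, Module k (D j)] [∀ j, Coalgebra k (D j)]
    (f : C →ₗc[k] E) (g : ∀ j, D j →ₗc[k] E) (x : C × ∀ j, D j) :
    CoalgHom.prodPiDesc f g x = f x.1 + ∑ j, g j (x.2 j) := by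
  change LinearMap.coprod f.toLinearMap (LinearMap.lsum k D k fun j => (g j).toLinearMap) x = _
  simp

end LinDualSlices

theorem QuaternionGroup.sum_eq {n : ℕ} [NeZero n] {M : Type*} [AddCommMonoid M]
    (f : QuaternionGroup n → M) : ∑ q, f q = ∑ j, f (.a j) + ∑ j, f (.xa j) := by
  let E : ZMod (2 * n) ⊕ ZMod (2 * n) ≃ QuaternionGroup n :=
    { toFun := Sum.elim .a .xa
      invFun := fun | .a j => .inl j | .xa j => .inr j
      left_inv := by rintro (j | j) <;> rfl
      right_inv := by rintro (j | j) <;> rfl }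
  rw [← E.sum_comp, Fintype.sum_sum_type]
  rfl

/-! ### Fourier inversion on ℤ/n -/

section Fourier
variable {k : Type*} [Field k] {n : ℕ} [NeZero n]
  {ψ : AddChar (ZMod n) k} (hψ : ψ.IsPrimitive)
include hψ

/-- Orthogonality of characters: the sum over m of ψ((L t - j)m) is n or 0. The labelling L of an
arbitrary finite index type lets one statement serve for inversion (ι = ℤ/n), for a single character
(ι = `Unit`) and for double sums coming from tensor products (ι a product). -/
theorem AddChar.IsPrimitive.sum_smul_sum_smul [NeZero (n : k)] {ι M : Type*} [Fintype ι]
    [AddCommGroup M] [Module k M]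
    (L : ι → ZMod n) (w : ι → M) (j : ZMod n) :
    (n : k)⁻¹ • ∑ m, ψ (-(j * m)) • ∑ t, ψ (L t * m) • w t =
      ∑ t, if L t = j then w t else 0 := by
  simp only [Finset.smul_sum, smul_smul]
  rw [Finset.sum_comm]
  refine Finset.sum_congr rfl fun t _ => ?_
  rw [← Finset.sum_smul, ← Finset.mul_sum]
  have h : ∑ m, ψ (-(j * m)) * ψ (L t * m) = if L t = j then (n : k) else 0 := by
    have h1 := AddChar.sum_mulShift (ψ := ψ) (L t - j) hψ
    simp only [sub_eq_zero, ZMod.card] at h1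
    push_cast at h1
    rw [← h1]
    refine Finset.sum_congr rfl fun m _ => ?_
    rw [← AddChar.map_add_eq_mul]
    congr 1
    ring
  rw [h]
  split_ifs <;> simp [NeZero.ne (n : k)]

end Fourier

/-! ### The idempotents of the subalgebra generated by a and x -/

namespace H8p
open MulOpposite Coalgebra

variable {k : Type*} [Field k] {p : ℕ} {i : {c : k // c ^ 2 = -1}}

local notation "A" => a k p i
local notation "X" => x k p i
local notation "Z" => z k p i
local notation "E₀" => e₀ k p i
local notation "E₁" => e₁ k p i
local notation "Y" => xinv k p i
local notation "G" => g k p i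

section Odd
variable [hp : Fact (Odd p)]

theorem neZero : NeZero p := ⟨hp.out.pos.ne'⟩

attribute [local instance] neZero

theorem natCast_add_natCast_self : (p : ZMod (2 * p)) + p = 0 := by
  rw [← two_mul]; exact_mod_cast ZMod.natCast_self (2 * p)

theorem natCast_ne_zero : (p : ZMod (2 * p)) ≠ 0 := by
  rw [Ne, ZMod.natCast_eq_zero_iff]
  have := hp.out.pos
  exact fun h => by have := Nat.le_of_dvd this h; omega

variable (k p i) in
/-- Powers of `x` with exponent in `ℤ/2p`. -/
def xpow (m : ZMod (2 * p)) : H8p k p i := X ^ m.val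

theorem xpow_natCast (n : ℕ) : xpow k p i n = X ^ n := by
  rw [xpow, ZMod.val_natCast, ← pow_eq_pow_mod n x_pow]

theorem xpow_add (m n : ZMod (2 * p)) : xpow k p i (m + n) = xpow k p i m * xpow k p i n := by
  conv_lhs => rw [← ZMod.natCast_zmod_val m, ← ZMod.natCast_zmod_val n, ← Nat.cast_add,
    xpow_natCast, pow_add]
  rfl

theorem xpow_zero : xpow k p i 0 = 1 := by
  simpa using xpow_natCast (k := k) (p := p) (i := i) 0

theorem xpow_one : xpow k p i 1 = X := by
  simpa using xpow_natCast (k := k) (p := p) (i := i) 1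

theorem xpow_p : xpow k p i p = X ^ p := xpow_natCast p

theorem xinv_pow (n : ℕ) : Y ^ n = xpow k p i (-n) := by
  have h1 : Y ^ n * X ^ n = 1 := by rw [← commute_xxinv.symm.mul_pow, xinv_x, one_pow]
  have h2 : X ^ n * xpow k p i (-n) = 1 := by
    rw [← xpow_natCast, ← xpow_add, add_neg_cancel, xpow_zero]
  exact left_inv_eq_right_inv h1 h2

theorem commute_a_xpow (m : ZMod (2 * p)) : Commute A (xpow k p i m) := commute_ax.pow_right _

variable [CharZero k] {ψ : AddChar (ZMod (2 * p)) k} (hψ : ψ.IsPrimitive)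

theorem neZero_two_mul : NeZero ((2 * p : ℕ) : k) :=
  ⟨Nat.cast_ne_zero.2 (NeZero.ne (2 * p))⟩

attribute [local instance] neZero_two_mul

-- The element p of ℤ/2p has order two, so ψ(p) is a square root of 1, and primitivity excludes 1.
-- This lets the signs (-1)^m be written as values of ψ and enter Fourier sums.
include hψ in
theorem char_p : ψ p = -1 := by
  have h1 : ψ p ^ 2 = 1 := by
    rw [sq, ← AddChar.map_add_eq_mul, natCast_add_natCast_self, AddChar.map_zero_eq_one]
  have h2 : ψ p ≠ 1 := by
    rw [Ne, hψ.zmod_char_eq_one_iff]; exact natCast_ne_zero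
  exact (sq_eq_one_iff.1 h1).resolve_left h2

include hψ in
theorem char_p_mul (m : ZMod (2 * p)) : ψ (p * m) = (-1) ^ m.val := by
  rw [← char_p hψ, ← AddChar.map_nsmul_eq_pow, nsmul_eq_mul, ZMod.natCast_zmod_val,
    mul_comm (p : ZMod (2 * p))]

/-- The primitive idempotents of the commutative subalgebra generated by `x`. -/
def xIdem (i : {c : k // c ^ 2 = -1}) (ψ : AddChar (ZMod (2 * p)) k) (j : ZMod (2 * p)) :
    H8p k p i :=
  ((2 * p : ℕ) : k)⁻¹ • ∑ m, ψ (-(j * m)) • xpow k p i m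

/-- Translating the summation index by n changes the coefficient by ψ(jn): the element is an
eigenvector of x with eigenvalue ψ(j). -/
theorem xpow_mul_xIdem (n j : ZMod (2 * p)) :
    xpow k p i n * xIdem i ψ j = ψ (j * n) • xIdem i ψ j := by
  simp only [xIdem, mul_smul_comm, Finset.mul_sum, ← xpow_add]
  rw [smul_comm]
  congr 1
  rw [Finset.smul_sum, ← Equiv.sum_comp (Equiv.addLeft n)
    fun m => ψ (j * n) • ψ (-(j * m)) • xpow k p i m]
  refine Finset.sum_congr rfl fun m _ => ?_
  rw [smul_smul, ← AddChar.map_add_eq_mul, Equiv.coe_addLeft]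
  congr 2
  ring

include hψ in
theorem xpow_eq_sum (n : ZMod (2 * p)) : xpow k p i n = ∑ j, ψ (j * n) • xIdem i ψ j := by
  have h := hψ.sum_smul_sum_smul (fun m => -m) (fun m => xpow k p i m) (-n)
  simp only [neg_inj, Finset.sum_ite_eq', Finset.mem_univ, if_true] at h
  rw [← h, Finset.smul_sum]
  refine Finset.sum_congr rfl fun j _ => ?_
  rw [xIdem, smul_comm]
  simp [mul_comm]

include hψ in
theorem xIdem_mul_xIdem (j l : ZMod (2 * p)) :
    xIdem i ψ j * xIdem i ψ l = if j = l then xIdem i ψ l else 0 := by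
  conv_lhs => rw [xIdem]
  simp only [smul_mul_assoc, Finset.sum_mul, xpow_mul_xIdem]
  simpa [eq_comm] using hψ.sum_smul_sum_smul (fun _ : Unit => l) (fun _ => xIdem i ψ l) j

theorem commute_a_xIdem (j : ZMod (2 * p)) : Commute A (xIdem i ψ j) :=
  (Commute.sum_right _ _ _ fun m _ => (commute_a_xpow m).smul_right _).smul_right _

/-- The primitive idempotents of the commutative subalgebra generated by `a` and `x`, indexed by
its characters, which form a dicyclic group. -/
def idem (i : {c : k // c ^ 2 = -1}) (ψ : AddChar (ZMod (2 * p)) k) :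
    QuaternionGroup p → H8p k p i
  | .a j => e₀ k p i * xIdem i ψ j
  | .xa j => e₁ k p i * xIdem i ψ j

include hψ in
theorem idem_mul_idem (q r : QuaternionGroup p) :
    idem i ψ q * idem i ψ r = if q = r then idem i ψ r else 0 := by
  have c0 : ∀ j, Commute (xIdem i ψ j) E₀ := fun j => (commute_e₀ (commute_a_xIdem j)).symm
  have c1 : ∀ j, Commute (xIdem i ψ j) E₁ := fun j => (commute_e₁ (commute_a_xIdem j)).symm
  rcases q with j | j <;> rcases r with l | l <;>
    simp only [idem, (c0 j).mul_mul_mul_comm, (c1 j).mul_mul_mul_comm, e₀_e₀, e₀_e₁, e₁_e₀, e₁_e₁,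
      xIdem_mul_xIdem hψ, QuaternionGroup.a.injEq, QuaternionGroup.xa.injEq, reduceCtorEq, if_false, ite_self,
      zero_mul, mul_ite, mul_zero]

include hψ in
theorem e₀_xpow_eq_sum (m : ZMod (2 * p)) :
    E₀ * xpow k p i m = ∑ j, ψ (j * m) • idem i ψ (.a j) := by
  rw [xpow_eq_sum hψ, Finset.mul_sum]; simp [idem]

include hψ in
theorem e₁_xpow_eq_sum (m : ZMod (2 * p)) :
    E₁ * xpow k p i m = ∑ j, ψ (j * m) • idem i ψ (.xa j) := by
  rw [xpow_eq_sum hψ, Finset.mul_sum]; simp [idem]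

theorem idem_a_eq (j : ZMod (2 * p)) : idem i ψ (.a j) =
    ((2 * p : ℕ) : k)⁻¹ • ∑ m, ψ (-(j * m)) • (E₀ * xpow k p i m) := by
  simp [idem, xIdem, Finset.mul_sum]

theorem idem_xa_eq (j : ZMod (2 * p)) : idem i ψ (.xa j) =
    ((2 * p : ℕ) : k)⁻¹ • ∑ m, ψ (-(j * m)) • (E₁ * xpow k p i m) := by
  simp [idem, xIdem, Finset.mul_sum]

include hψ in
theorem sum_idem : ∑ q, idem i ψ q = 1 := by
  have h0 := e₀_xpow_eq_sum (i := i) hψ 0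
  have h1 := e₁_xpow_eq_sum (i := i) hψ 0
  simp only [xpow_zero, mul_one, mul_zero, AddChar.map_zero_eq_one, one_smul] at h0 h1
  rw [QuaternionGroup.sum_eq, ← h0, ← h1, e₀_add_e₁]

include hψ in
theorem a_eq_sum_idem : A = ∑ j, idem i ψ (.a j) - ∑ j, idem i ψ (.xa j) := by
  have h0 := e₀_xpow_eq_sum (i := i) hψ 0
  have h1 := e₁_xpow_eq_sum (i := i) hψ 0
  simp only [xpow_zero, mul_one, mul_zero, AddChar.map_zero_eq_one, one_smul] at h0 h1
  rw [← h0, ← h1, e₀_sub_e₁]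

include hψ in
theorem xpow_eq_sum_idem (m : ZMod (2 * p)) :
    xpow k p i m = ∑ j, ψ (j * m) • idem i ψ (.a j) + ∑ j, ψ (j * m) • idem i ψ (.xa j) := by
  rw [← e₀_xpow_eq_sum hψ, ← e₁_xpow_eq_sum hψ, ← add_mul, e₀_add_e₁, one_mul]

theorem a_mul_idem_a (j : ZMod (2 * p)) : A * idem i ψ (.a j) = idem i ψ (.a j) := by
  rw [idem, ← mul_assoc, a_e₀]

theorem a_mul_idem_xa (j : ZMod (2 * p)) : A * idem i ψ (.xa j) = -idem i ψ (.xa j) := by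
  rw [idem, ← mul_assoc, a_e₁, neg_mul]

theorem e₀_mul_a_pow (n : ℕ) : E₀ * A ^ n = E₀ := by
  induction n with
  | zero => simp
  | succ n ih => rw [pow_succ, ← mul_assoc, ih, e₀_a]

theorem e₁_mul_a_pow (n : ℕ) : E₁ * A ^ n = ((-1) ^ n : k) • E₁ := by
  induction n with
  | zero => simp
  | succ n ih => rw [pow_succ, ← mul_assoc, ih, smul_mul_assoc, e₁_a, pow_succ]; simp

/-! ### Comultiplication and the dicyclic group law -/

theorem comul_xpow (m : ZMod (2 * p)) : comul (R := k) (xpow k p i m) =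
    xpow k p i m ⊗ₜ (E₀ * xpow k p i m) +
      (A ^ m.val * xpow k p i (-m)) ⊗ₜ (E₁ * xpow k p i m) := by
  have h : Y ^ m.val = xpow k p i (-m) := by rw [xinv_pow, ZMod.natCast_zmod_val]
  rw [← h]
  exact comulHom_x_pow m.val

theorem comul_e₀ : comul (R := k) E₀ = E₀ ⊗ₜ E₀ + E₁ ⊗ₜ E₁ := comulHom_e₀
theorem comul_e₁ : comul (R := k) E₁ = E₀ ⊗ₜ E₁ + E₁ ⊗ₜ E₀ := comulHom_e₁

-- Since e₁a = -e₁, the factor a^m in Δ(x^m) becomes the sign (-1)^m = ψ(pm). This sign is what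
-- makes the dual group dicyclic instead of dihedral.
include hψ in
theorem comul_e₀_mul_xpow (m : ZMod (2 * p)) : comul (R := k) (E₀ * xpow k p i m) =
    (E₀ * xpow k p i m) ⊗ₜ (E₀ * xpow k p i m) +
      ψ (p * m) • (E₁ * xpow k p i (-m)) ⊗ₜ (E₁ * xpow k p i m) := by
  rw [Bialgebra.comul_mul, comul_xpow, comul_e₀, char_p_mul hψ]
  simp only [mul_add, add_mul, Algebra.TensorProduct.tmul_mul_tmul, ← mul_assoc, e₀_mul_a_pow,
    e₁_mul_a_pow, e₀_e₀, e₀_e₁, e₁_e₀, e₁_e₁, zero_mul, TensorProduct.tmul_zero, add_zero, zero_add,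
    smul_mul_assoc, TensorProduct.smul_tmul']

include hψ in
theorem comul_e₁_mul_xpow (m : ZMod (2 * p)) : comul (R := k) (E₁ * xpow k p i m) =
    (E₁ * xpow k p i m) ⊗ₜ (E₀ * xpow k p i m) +
      (E₀ * xpow k p i (-m)) ⊗ₜ (E₁ * xpow k p i m) := by
  rw [Bialgebra.comul_mul, comul_xpow, comul_e₁]
  simp only [mul_add, add_mul, Algebra.TensorProduct.tmul_mul_tmul, ← mul_assoc, e₀_mul_a_pow,
    e₀_e₀, e₀_e₁, e₁_e₀, e₁_e₁, zero_mul, TensorProduct.tmul_zero, add_zero, zero_add]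

-- Expanding both tensor factors by Fourier inversion gives double sums whose phases are linear in
-- m; the outer sum over m keeps exactly the pairs whose product in the group is t. The summand p in
-- the phase of the xa ⊗ xa terms is the sign ψ(pm), and corresponds to xa 0 having square a p.
include hψ in
theorem comul_idem (t : QuaternionGroup p) :
    comul (R := k) (idem i ψ t) = ∑ q, idem i ψ q ⊗ₜ idem i ψ (q⁻¹ * t) := by
  have fourier : ∀ (L : ZMod (2 * p) × ZMod (2 * p) → ZMod (2 * p))
      (w : ZMod (2 * p) → ZMod (2 * p) → H8p k p i ⊗[k] H8p k p i) (j : ZMod (2 * p))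
      (F : ZMod (2 * p) → ZMod (2 * p)) (hF : ∀ a b, L (a, b) = j ↔ b = F a),
      ((2 * p : ℕ) : k)⁻¹ • ∑ m, ψ (-(j * m)) • ∑ a, ∑ b, ψ (L (a, b) * m) • w a b =
        ∑ a, w a (F a) := by
    intro L w j F hF
    have h := hψ.sum_smul_sum_smul L (fun t => w t.1 t.2) j
    simp only [Fintype.sum_prod_type, hF] at h
    simpa using h
  have key : ∀ (u v : ZMod (2 * p) → H8p k p i) (r s : ZMod (2 * p)),
      (∑ a, ψ (a * r) • u a) ⊗ₜ[k] (∑ b, ψ (b * s) • v b) =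
        ∑ a, ∑ b, ψ (a * r + b * s) • u a ⊗ₜ[k] v b := by
    intro u v r s
    rw [TensorProduct.sum_tmul]
    refine Finset.sum_congr rfl fun a _ => ?_
    rw [TensorProduct.tmul_sum]
    refine Finset.sum_congr rfl fun b _ => ?_
    rw [TensorProduct.smul_tmul_smul, AddChar.map_add_eq_mul]
  have h2p := natCast_add_natCast_self (p := p)
  rcases t with j | j
  · have s1 : ∀ m, comul (R := k) (E₀ * xpow k p i m) =
        ∑ a, ∑ b, ψ ((a + b) * m) • idem i ψ (.a a) ⊗ₜ idem i ψ (.a b) +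
        ∑ a, ∑ b, ψ ((p - a + b) * m) • idem i ψ (.xa a) ⊗ₜ idem i ψ (.xa b) := by
      intro m
      rw [comul_e₀_mul_xpow hψ]
      simp only [e₀_xpow_eq_sum hψ, e₁_xpow_eq_sum hψ, key]
      simp only [Finset.smul_sum, smul_smul, ← AddChar.map_add_eq_mul]
      simp only [add_mul, mul_neg, neg_mul, sub_eq_add_neg, add_assoc]
    rw [idem_a_eq, map_smul, map_sum, QuaternionGroup.sum_eq]
    simp only [map_smul, s1, smul_add, Finset.sum_add_distrib]
    -- The solutions for b are written in the form to which q⁻¹ * t unfolds in `QuaternionGroup`, so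
    -- that the final comparison is definitional.
    rw [fourier (fun t => t.1 + t.2) (fun a b => idem i ψ (.a a) ⊗ₜ idem i ψ (.a b)) j
        (fun a => -a + j) (fun a b => ⟨fun h => by rw [← h]; ring, fun h => by rw [h]; ring⟩),
      fourier (fun t => p - t.1 + t.2) (fun a b => idem i ψ (.xa a) ⊗ₜ idem i ψ (.xa b)) j
        (fun a => p + a + j)
        (fun a b => ⟨fun h => by linear_combination h - h2p, fun h => by linear_combination h + h2p⟩)]
    rfl
  · have s1 : ∀ m, comul (R := k) (E₁ * xpow k p i m) =
        ∑ a, ∑ b, ψ ((a + b) * m) • idem i ψ (.xa a) ⊗ₜ idem i ψ (.a b) +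
        ∑ a, ∑ b, ψ ((- a + b) * m) • idem i ψ (.a a) ⊗ₜ idem i ψ (.xa b) := by
      intro m
      rw [comul_e₁_mul_xpow hψ]
      simp only [e₀_xpow_eq_sum hψ, e₁_xpow_eq_sum hψ, key]
      simp only [add_mul, mul_neg, neg_mul]
    rw [idem_xa_eq, map_smul, map_sum, QuaternionGroup.sum_eq]
    simp only [map_smul, s1, smul_add, Finset.sum_add_distrib]
    rw [fourier (fun t => t.1 + t.2) (fun a b => idem i ψ (.xa a) ⊗ₜ idem i ψ (.a b)) j
        (fun a => p + j - (p + a))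
        (fun a b => ⟨fun h => by rw [← h]; ring, fun h => by rw [h]; ring⟩),
      fourier (fun t => - t.1 + t.2) (fun a b => idem i ψ (.a a) ⊗ₜ idem i ψ (.xa b)) j
        (fun a => j - -a)
        (fun a b => ⟨fun h => by rw [← h]; ring, fun h => by rw [h]; ring⟩), add_comm]
    rfl

/-! ### Two-dimensional representations and a basis -/

section Rep

include hψ in
theorem char_add_p (j : ZMod (2 * p)) : ψ (j + p) = -ψ j := by
  rw [AddChar.map_add_eq_mul, char_p hψ, mul_neg_one]

/-- The representation `x ↦ diag(ψ j, -ψ j)`, `a ↦ s` of `H_{8p}`, where `s = ±1`. -/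
def rep (i : {c : k // c ^ 2 = -1}) (hψ : ψ.IsPrimitive) (j : ZMod (2 * p)) (s : k)
    (hs : s ^ 2 = 1) : H8p k p i →ₐ[k] Matrix (Fin 2) (Fin 2) k :=
  -- As z anticommutes with x it exchanges the eigenlines for ψ(j) and -ψ(j) = ψ(j + p). The
  -- off-diagonal entries must multiply to s - 1; keeping the lower one equal to 1 keeps z nonzero
  -- when s = 1.
  lift i (Matrix.diagonal fun _ => s) (Matrix.diagonal ![ψ j, ψ (j + p)]) !![0, s - 1; 1, 0]
    (by rw [Matrix.diagonal_pow, ← Matrix.diagonal_one]; congr 1; ext l; exact hs)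
    (by
      have h : ∀ j, ψ j ^ (2 * p) = 1 := fun j => by
        rw [← AddChar.map_nsmul_eq_pow, nsmul_eq_mul, ZMod.natCast_self, zero_mul,
          AddChar.map_zero_eq_one]
      rw [Matrix.diagonal_pow, ← Matrix.diagonal_one]
      congr 1
      ext l
      fin_cases l <;> simp [h])
    (by
      ext l m
      fin_cases l <;> fin_cases m <;> simp [sq, Matrix.mul_apply])
    (by simp [mul_comm])
    (by
      ext l m
      fin_cases l <;> fin_cases m <;> simp [Matrix.mul_apply, mul_comm])
    (by
      ext l m
      fin_cases l <;> fin_cases m <;> simp [Matrix.mul_apply, Matrix.vecMul_diagonal, char_add_p hψ, mul_comm])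

variable (j : ZMod (2 * p)) (s : k) (hs : s ^ 2 = 1)

theorem rep_a : rep i hψ j s hs A = Matrix.diagonal fun _ => s := by simp [rep]
theorem rep_x : rep i hψ j s hs X = Matrix.diagonal ![ψ j, ψ (j + p)] := by simp [rep]
theorem rep_z : rep i hψ j s hs Z = !![0, s - 1; 1, 0] := by simp [rep]

theorem rep_xpow (m : ZMod (2 * p)) : rep i hψ j s hs (xpow k p i m) =
    Matrix.diagonal ![ψ (j * m), ψ ((j + p) * m)] := by
  have h : ∀ j, ψ j ^ m.val = ψ (j * m) := fun j => by
    rw [← AddChar.map_nsmul_eq_pow, nsmul_eq_mul, ZMod.natCast_zmod_val, mul_comm j]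
  rw [xpow, map_pow, rep_x, Matrix.diagonal_pow]
  congr 1
  ext l
  fin_cases l <;> simp [h]

theorem rep_xIdem (l : ZMod (2 * p)) : rep i hψ j s hs (xIdem i ψ l) =
    Matrix.diagonal ![if j = l then 1 else 0, if j + p = l then 1 else 0] := by
  have h := hψ.sum_smul_sum_smul (fun _ : Unit => j) (fun _ => (1 : k)) l
  have h' := hψ.sum_smul_sum_smul (fun _ : Unit => j + p) (fun _ => (1 : k)) l
  simp only [smul_eq_mul, Finset.univ_unique, Finset.sum_singleton, mul_one] at h h'
  rw [xIdem, map_smul, map_sum, ← h, ← h']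
  simp only [map_smul, rep_xpow]
  ext a b
  fin_cases a <;> fin_cases b <;> simp [Matrix.sum_apply, Finset.mul_sum]

theorem rep_e₀ : rep i hψ j s hs E₀ = Matrix.diagonal fun _ => 2⁻¹ * (1 + s) := by
  rw [e₀, map_smul, map_add, map_one, rep_a, ← Matrix.diagonal_one, Matrix.diagonal_add,
    ← Matrix.diagonal_smul]
  rfl

theorem rep_e₁ : rep i hψ j s hs E₁ = Matrix.diagonal fun _ => 2⁻¹ * (1 - s) := by
  rw [e₁, map_smul, map_sub, map_one, rep_a, ← Matrix.diagonal_one, Matrix.diagonal_sub,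
    ← Matrix.diagonal_smul]
  rfl

/-- The representations of `H_{8p}` indexed by the dicyclic group. -/
def dicRep (i : {c : k // c ^ 2 = -1}) (hψ : ψ.IsPrimitive) :
    QuaternionGroup p → H8p k p i →ₐ[k] Matrix (Fin 2) (Fin 2) k
  | .a j => rep i hψ j 1 (by ring)
  | .xa j => rep i hψ j (-1) (by ring)

/-- Both a and x act diagonally, so each idempotent acts as the projection on a coordinate line or
as zero. Right multiplication by `.a p` passes from the label of the first line to that of the
second. -/
theorem dicRep_idem (q r : QuaternionGroup p) : dicRep i hψ q (idem i ψ r) =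
    Matrix.diagonal ![if q = r then 1 else 0, if q * .a p = r then 1 else 0] := by
  rcases q with j | j <;> rcases r with l | l <;>
    simp only [dicRep, idem, map_mul, rep_e₀, rep_e₁, rep_xIdem, Matrix.diagonal_mul_diagonal,
      QuaternionGroup.a_mul_a, QuaternionGroup.xa_mul_a, QuaternionGroup.a.injEq,
      QuaternionGroup.xa.injEq, reduceCtorEq, if_false] <;>
    congr 1 <;> ext b <;> fin_cases b <;> norm_num

theorem dicRep_idem_mul_z (q r : QuaternionGroup p) : dicRep i hψ q (idem i ψ r * Z) =
    !![0, if q = r then dicRep i hψ q Z 0 1 else 0; if q * .a p = r then 1 else 0, 0] := by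
  rw [map_mul, dicRep_idem]
  rcases q with j | j <;>
  · simp only [dicRep, rep_z]
    ext a b
    fin_cases a <;> fin_cases b <;> simp

/-- The coordinates with respect to the basis `idem q * z ^ l`. -/
def coord (i : {c : k // c ^ 2 = -1}) (hψ : ψ.IsPrimitive) :
    QuaternionGroup p × Fin 2 → Module.Dual k (H8p k p i)
  | (q, 0) => Matrix.entryLinearMap k k 0 0 ∘ₗ (dicRep i hψ q).toLinearMap
  | (q, 1) => Matrix.entryLinearMap k k 1 0 ∘ₗ (dicRep i hψ (q * .a p)).toLinearMap

/-- The idempotents act by diagonal matrices and their products with z by off-diagonal ones, so the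
two kinds do not interfere. The entry (1, 0) is used because it is 1 for both signs of a, whereas
the entry (0, 1) of z vanishes when a acts by 1; it reads the second label q * a p, whence the twist
in `coord`, undone because a p has order two. -/
theorem coord_idem_mul_z_pow (t u : QuaternionGroup p × Fin 2) :
    coord i hψ t (idem i ψ u.1 * Z ^ (u.2 : ℕ)) = if t = u then 1 else 0 := by
  have h : ∀ q : QuaternionGroup p, q * .a p * .a p = q := fun q => by
    rw [mul_assoc, QuaternionGroup.a_mul_a, natCast_add_natCast_self, QuaternionGroup.a_zero,
      mul_one]
  obtain ⟨q, l⟩ := t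
  obtain ⟨r, m⟩ := u
  fin_cases l <;> fin_cases m <;> simp [coord, dicRep_idem, dicRep_idem_mul_z, h]

end Rep

include hψ in
theorem span_idem_mul_z_pow : Submodule.span k (Set.range fun t : QuaternionGroup p × Fin 2 =>
    idem i ψ t.1 * Z ^ (t.2 : ℕ)) = ⊤ := by
  rw [eq_top_iff, ← monomialSpan_eq_top (NeZero.ne p), monomialSpan, Submodule.span_le]
  rintro _ ⟨⟨n, m, l⟩, rfl⟩
  have h : A ^ (n : ℕ) * X ^ (m : ℕ) ∈ Submodule.span k (Set.range (idem i ψ)) := by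
    have hx : xpow k p i m ∈ Submodule.span k (Set.range (idem i ψ)) := by
      rw [xpow_eq_sum_idem hψ]
      exact Submodule.add_mem _
        (Submodule.sum_mem _ fun j _ => Submodule.smul_mem _ _ (Submodule.subset_span ⟨_, rfl⟩))
        (Submodule.sum_mem _ fun j _ => Submodule.smul_mem _ _ (Submodule.subset_span ⟨_, rfl⟩))
    rw [← xpow_natCast]
    induction (n : ℕ) with
    | zero => simpa using hx
    | succ n ih =>
      rw [pow_succ', mul_assoc]
      generalize A ^ n * xpow k p i m = w at ih
      induction ih using Submodule.span_induction with
      | mem w hw =>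
        obtain ⟨q | q, rfl⟩ := hw
        · rw [a_mul_idem_a]; exact Submodule.subset_span ⟨_, rfl⟩
        · rw [a_mul_idem_xa]; exact Submodule.neg_mem _ (Submodule.subset_span ⟨_, rfl⟩)
      | zero => simp
      | add u v _ _ hu hv => rw [mul_add]; exact Submodule.add_mem _ hu hv
      | smul r u _ hu => rw [mul_smul_comm]; exact Submodule.smul_mem _ _ hu
  change A ^ (n : ℕ) * X ^ (m : ℕ) * Z ^ (l : ℕ) ∈ _
  generalize A ^ (n : ℕ) * X ^ (m : ℕ) = w at h
  induction h using Submodule.span_induction with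
  | mem w hw =>
    obtain ⟨q, rfl⟩ := hw
    exact Submodule.subset_span ⟨(q, l), rfl⟩
  | zero => simp
  | add u v _ _ hu hv => rw [add_mul]; exact Submodule.add_mem _ hu hv
  | smul r u _ hu => rw [smul_mul_assoc]; exact Submodule.smul_mem _ _ hu

/-- The basis `idem q * z ^ l` of `H_{8p}`. -/
def basis (i : {c : k // c ^ 2 = -1}) (hψ : ψ.IsPrimitive) :
    Module.Basis (QuaternionGroup p × Fin 2) k (H8p k p i) :=
  .mk (v := fun t => idem i ψ t.1 * z k p i ^ (t.2 : ℕ))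
    (by
      rw [Fintype.linearIndependent_iff]
      intro c hc t
      have := congrArg (coord i hψ t) hc
      simpa [coord_idem_mul_z_pow] using this)
    (span_idem_mul_z_pow hψ).ge

theorem basis_zero (q : QuaternionGroup p) : basis i hψ (q, 0) = idem i ψ q := by simp [basis]
theorem basis_one (q : QuaternionGroup p) : basis i hψ (q, 1) = idem i ψ q * Z := by simp [basis]

include hψ in
theorem finrank_eq : Module.finrank k (H8p k p i) = 8 * p := by
  rw [Module.finrank_eq_card_basis (basis i hψ), Fintype.card_prod, QuaternionGroup.card,
    Fintype.card_fin]
  ring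

/-! ### The coradical of H -/

variable (i ψ) in
/-- The linear span of the idempotents `idem q`, which is the subalgebra generated by `a`, `x`. -/
def idemSpan : Submodule k (H8p k p i) := Submodule.span k (Set.range (idem i ψ))

theorem idem_mem (q : QuaternionGroup p) : idem i ψ q ∈ idemSpan i ψ := Submodule.subset_span ⟨q, rfl⟩

include hψ in
theorem e₀_mul_xpow_mem (m : ZMod (2 * p)) : E₀ * xpow k p i m ∈ idemSpan i ψ := by
  rw [e₀_xpow_eq_sum hψ]
  exact Submodule.sum_mem _ fun j _ => Submodule.smul_mem _ _ (idem_mem _)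

include hψ in
theorem e₁_mul_xpow_mem (m : ZMod (2 * p)) : E₁ * xpow k p i m ∈ idemSpan i ψ := by
  rw [e₁_xpow_eq_sum hψ]
  exact Submodule.sum_mem _ fun j _ => Submodule.smul_mem _ _ (idem_mem _)

include hψ in
theorem g_mem : G ∈ idemSpan i ψ := by
  rw [g, ← xpow_p, add_mul, smul_mul_assoc]
  exact Submodule.add_mem _ (e₀_mul_xpow_mem hψ _) (Submodule.smul_mem _ _ (e₁_mul_xpow_mem hψ _))

include hψ in
theorem idem_mul_mem (q : QuaternionGroup p) {w : H8p k p i} (hw : w ∈ idemSpan i ψ) :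
    idem i ψ q * w ∈ idemSpan i ψ := by
  induction hw using Submodule.span_induction with
  | mem w hw =>
    obtain ⟨r, rfl⟩ := hw
    rw [idem_mul_idem hψ]
    split_ifs
    · exact idem_mem r
    · exact Submodule.zero_mem _
  | zero => simp
  | add u v _ _ hu hv => rw [mul_add]; exact Submodule.add_mem _ hu hv
  | smul r u _ hu => rw [mul_smul_comm]; exact Submodule.smul_mem _ _ hu

include hψ in
theorem isSubcoalgebra_idemSpan : IsSubcoalgebra k (idemSpan i ψ) := by
  rw [isSubcoalgebra_iff]
  intro c hc f
  induction hc using Submodule.span_induction with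
  | mem w hw =>
    obtain ⟨t, rfl⟩ := hw
    simp only [comul_idem hψ, map_sum, sliceLeft_tmul, sliceRight_tmul]
    exact ⟨Submodule.sum_mem _ fun q _ => Submodule.smul_mem _ _ (idem_mem _),
      Submodule.sum_mem _ fun q _ => Submodule.smul_mem _ _ (idem_mem _)⟩
  | zero => simp
  | add u v _ _ hu hv =>
    simp only [map_add]
    exact ⟨Submodule.add_mem _ hu.1 hv.1, Submodule.add_mem _ hu.2 hv.2⟩
  | smul r u _ hu =>
    simp only [map_smul]
    exact ⟨Submodule.smul_mem _ _ hu.1, Submodule.smul_mem _ _ hu.2⟩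

-- In Δ(idem t · z) the terms coming from g ⊗ z have their left factor in the span B of the
-- idempotents, because g ∈ B, and are killed by f; the terms coming from z ⊗ 1 have their right
-- factor in B.
include hψ in
theorem coradical_le_idemSpan : coradical k (H8p k p i) ≤ idemSpan i ψ := by
  refine coradical_le (isSubcoalgebra_idemSpan hψ) fun f hf c => ?_
  have hc : c ∈ Submodule.span k (Set.range (basis i hψ)) := by
    rw [(basis i hψ).span_eq]; trivial
  induction hc using Submodule.span_induction with
  | mem w hw =>
    obtain ⟨⟨t, l⟩, rfl⟩ := hw
    match l with
    | 0 =>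
      simp only [basis_zero, comul_idem hψ, map_sum, sliceLeft_tmul]
      exact Submodule.sum_mem _ fun q _ => Submodule.smul_mem _ _ (idem_mem _)
    | 1 =>
      simp only [basis_one, Bialgebra.comul_mul, comul_z, comul_idem hψ, mul_add, Finset.sum_mul,
        Algebra.TensorProduct.tmul_mul_tmul, map_add, map_sum, sliceLeft_tmul, mul_one,
        hf _ (idem_mul_mem hψ _ (g_mem hψ)), zero_smul, Finset.sum_const_zero, zero_add]
      exact Submodule.sum_mem _ fun q _ => Submodule.smul_mem _ _ (idem_mem _)
  | zero => simp
  | add u v _ _ hu hv =>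
    simp only [map_add]
    exact Submodule.add_mem _ hu hv
  | smul r u _ hu =>
    simp only [map_smul]
    exact Submodule.smul_mem _ _ hu

/-- The functionals dual to the elements `e₀ * x ^ m` (for `s = a`) and `e₁ * x ^ m` (for
`s = xa`). -/
def xCoord (i : {c : k // c ^ 2 = -1}) (hψ : ψ.IsPrimitive) (s : ZMod (2 * p) → QuaternionGroup p)
    (m : ZMod (2 * p)) : Module.Dual k (H8p k p i) :=
  ((2 * p : ℕ) : k)⁻¹ • ∑ j, ψ (-(m * j)) • coord i hψ (s j, 0)

theorem coord_idem (q r : QuaternionGroup p) :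
    coord i hψ (q, 0) (idem i ψ r) = if q = r then 1 else 0 := by
  simpa using coord_idem_mul_z_pow (i := i) hψ (q, 0) (r, 0)

theorem xCoord_e₀ (m n : ZMod (2 * p)) :
    xCoord i hψ .a m (E₀ * xpow k p i n) = if m = n then 1 else 0 := by
  have h := hψ.sum_smul_sum_smul (fun _ : Unit => n) (fun _ => (1 : k)) m
  simp only [smul_eq_mul, Finset.univ_unique, Finset.sum_singleton, mul_one, @eq_comm _ n] at h
  rw [← h, xCoord, e₀_xpow_eq_sum hψ]
  simp only [map_sum, map_smul, LinearMap.smul_apply, LinearMap.sum_apply, coord_idem, smul_eq_mul,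
    QuaternionGroup.a.injEq, mul_ite, mul_one, mul_zero,
    Finset.sum_ite_eq', Finset.mem_univ, if_true, Finset.mul_sum]
  exact Finset.sum_congr rfl fun j _ => by rw [mul_comm n]; ring

theorem xCoord_e₁ (m n : ZMod (2 * p)) :
    xCoord i hψ .xa m (E₁ * xpow k p i n) = if m = n then 1 else 0 := by
  have h := hψ.sum_smul_sum_smul (fun _ : Unit => n) (fun _ => (1 : k)) m
  simp only [smul_eq_mul, Finset.univ_unique, Finset.sum_singleton, mul_one, @eq_comm _ n] at h
  rw [← h, xCoord, e₁_xpow_eq_sum hψ]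
  simp only [map_sum, map_smul, LinearMap.smul_apply, LinearMap.sum_apply, coord_idem, smul_eq_mul,
    QuaternionGroup.xa.injEq, mul_ite, mul_one, mul_zero,
    Finset.sum_ite_eq', Finset.mem_univ, if_true, Finset.mul_sum]
  exact Finset.sum_congr rfl fun j _ => by rw [mul_comm n]; ring

theorem xCoord_a_e₁ (m n : ZMod (2 * p)) : xCoord i hψ .a m (E₁ * xpow k p i n) = 0 := by
  rw [xCoord, e₁_xpow_eq_sum hψ]
  simp [coord_idem]

theorem xCoord_xa_e₀ (m n : ZMod (2 * p)) : xCoord i hψ .xa m (E₀ * xpow k p i n) = 0 := by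
  rw [xCoord, e₀_xpow_eq_sum hψ]
  simp [coord_idem]

-- The formulas for Δ(e₀x^m) and Δ(e₁x^m), for m and -m, are those of a 2×2 comatrix once the sign
-- ψ(pm) is put into the upper right entry. The condition m ≠ -m makes the four entries independent,
-- so the block is simple.
include hψ in
theorem mem_coradical_of_ne {m : ZMod (2 * p)} (hm : m ≠ -m) :
    E₀ * xpow k p i m ∈ coradical k (H8p k p i) ∧ E₁ * xpow k p i m ∈ coradical k (H8p k p i) := by
  let c : Fin 2 → Fin 2 → H8p k p i :=
    ![![E₀ * xpow k p i m, ψ (p * m) • (E₁ * xpow k p i (-m))],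
      ![E₁ * xpow k p i m, E₀ * xpow k p i (-m)]]
  let f : Fin 2 → Fin 2 → Module.Dual k (H8p k p i) :=
    ![![xCoord i hψ .a m, ψ (p * m) • xCoord i hψ .xa (-m)],
      ![xCoord i hψ .xa m, xCoord i hψ .a (-m)]]
  have hψ2 : ψ (p * m) * ψ (p * m) = 1 := by
    rw [← AddChar.map_add_eq_mul, ← add_mul, natCast_add_natCast_self, zero_mul,
      AddChar.map_zero_eq_one]
  have hn : ψ (-(p * m)) = ψ (p * m) := by
    congr 1
    linear_combination -m * natCast_add_natCast_self (p := p)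
  have h := isSimpleSubcoalgebra_of_comatrix (k := k) c
    (by
      intro a b
      fin_cases a <;> fin_cases b <;>
        simp [c, comul_e₀_mul_xpow hψ, comul_e₁_mul_xpow hψ, Fin.sum_univ_two,
          TensorProduct.smul_tmul', hn, add_comm])
    f
    (by
      intro a b a' b'
      fin_cases a <;> fin_cases b <;> fin_cases a' <;> fin_cases b' <;>
        simp [c, f, xCoord_e₀, xCoord_e₁, xCoord_a_e₁, xCoord_xa_e₀, hm, hm.symm, hψ2])
  exact ⟨h.le_coradical (Submodule.subset_span ⟨(0, 0), rfl⟩),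
    h.le_coradical (Submodule.subset_span ⟨(1, 0), rfl⟩)⟩

-- When m = -m the comatrix block collapses: with u = e₀x^m and v = e₁x^m one has Δu = u ⊗ u + c² v
-- ⊗ v and Δv = v ⊗ u + u ⊗ v, so u + cv is group-like.
include hψ in
theorem isGroupLikeElem_of_eq_neg {m : ZMod (2 * p)} (hm : m = -m) {c : k}
    (hc : c * c = ψ (p * m)) : IsGroupLikeElem k (E₀ * xpow k p i m + c • (E₁ * xpow k p i m)) where
  counit_eq_one := by
    change counitHom k p i _ = 1
    simp [xpow, counitHom_e₀, counitHom_e₁, counitHom_x]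
  comul_eq_tmul_self := by
    rw [map_add, map_smul, comul_e₀_mul_xpow hψ, comul_e₁_mul_xpow hψ, ← hm, ← hc]
    simp only [TensorProduct.add_tmul, TensorProduct.tmul_add, TensorProduct.tmul_smul,
      ← TensorProduct.smul_tmul', smul_smul, smul_add]
    abel

-- In the case m = -m both roots ±c of c² = ψ(pm) give group-like elements, and their half sum and
-- scaled difference recover e₀x^m and e₁x^m. For an odd exponent c is √-1, as in the definition of
-- g.
include hψ in
theorem mem_coradical (m : ZMod (2 * p)) :
    E₀ * xpow k p i m ∈ coradical k (H8p k p i) ∧ E₁ * xpow k p i m ∈ coradical k (H8p k p i) := by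
  by_cases hm : m = -m
  · obtain ⟨c, hc0, hc⟩ : ∃ c : k, c ≠ 0 ∧ c * c = ψ (p * m) := by
      rw [char_p_mul hψ]
      rcases neg_one_pow_eq_or k m.val with h | h
      · exact ⟨1, one_ne_zero, by rw [h, one_mul]⟩
      · refine ⟨i, fun h0 => ?_, by rw [h, ← sq, i.2]⟩
        have := i.2
        rw [h0] at this
        norm_num at this
    have h1 := (isSimpleSubcoalgebra_of_isGroupLikeElem
      (isGroupLikeElem_of_eq_neg (i := i) hψ hm hc)).le_coradical (Submodule.mem_span_singleton_self _)
    have h2 := (isSimpleSubcoalgebra_of_isGroupLikeElem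
      (isGroupLikeElem_of_eq_neg (i := i) hψ hm (c := -c) (by rw [neg_mul_neg, hc]))).le_coradical
      (Submodule.mem_span_singleton_self _)
    constructor
    · have h3 := Submodule.smul_mem _ (2⁻¹ : k) (Submodule.add_mem _ h1 h2)
      convert h3 using 1
      module
    · have h3 := Submodule.smul_mem _ (c⁻¹ * 2⁻¹ : k) (Submodule.sub_mem _ h1 h2)
      convert h3 using 1
      match_scalars <;> field_simp <;> norm_num
  · exact mem_coradical_of_ne hψ hm

include hψ in
theorem coradical_eq : coradical k (H8p k p i) = idemSpan i ψ := by
  refine le_antisymm (coradical_le_idemSpan hψ) (Submodule.span_le.2 ?_)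
  rintro _ ⟨q | q, rfl⟩
  · rw [idem_a_eq]
    exact Submodule.smul_mem _ _
      (Submodule.sum_mem _ fun m _ => Submodule.smul_mem _ _ (mem_coradical hψ m).1)
  · rw [idem_xa_eq]
    exact Submodule.smul_mem _ _
      (Submodule.sum_mem _ fun m _ => Submodule.smul_mem _ _ (mem_coradical hψ m).2)

-- A pointed coradical would be cocommutative, but it contains e₁x, whose comultiplication is not
-- symmetric as soon as 1 ≠ -1 in ℤ/2p, that is, for p ≠ 1.
include hψ in
theorem not_isPointedCoalgebra (h1 : p ≠ 1) : ¬ IsPointedCoalgebra k (H8p k p i) := by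
  intro h
  have hne : (1 : ZMod (2 * p)) ≠ -1 := by
    intro h2
    have h3 : ((2 : ℕ) : ZMod (2 * p)) = 0 := by push_cast; linear_combination h2
    rw [ZMod.natCast_eq_zero_iff] at h3
    have := Nat.le_of_dvd two_pos h3
    have := hp.out.pos
    omega
  have hm := (mem_coradical (i := i) hψ 1).2
  rw [IsPointedCoalgebra] at h
  rw [h] at hm
  have h4 := comm_comul_of_mem_span_isGroupLikeElem hm
  rw [comul_e₁_mul_xpow hψ] at h4
  -- The functional dual to e₁x on the left and the one dual to e₀x on the right give 1 on Δ(e₁x)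
  -- and 0 on its flip, where e₁x is paired with e₀x⁻¹.
  have h5 := congrArg (fun t => xCoord i hψ .a 1 (sliceLeft (xCoord i hψ .xa 1) t)) h4
  simp [xCoord_e₀, xCoord_e₁, xCoord_xa_e₀, hne] at h5

/-! ### The nilpotent normal element e₀z -/

include hψ in
theorem e₀_mul_z_ne_zero : E₀ * Z ≠ 0 := by
  intro h
  have h1 : basis i hψ (.a 0, 1) = 0 := by
    rw [basis_one, idem, (commute_e₀ (commute_a_xIdem (0 : ZMod (2 * p)))).eq, mul_assoc, h, mul_zero]
  exact (basis i hψ).ne_zero _ h1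

/-- Up to the choice of a coefficient, `e₀ z` is normal in `H_{8p}`. -/
theorem exists_e₀_mul_z_mul (h : H8p k p i) : ∃ h', E₀ * Z * h = h' * (E₀ * Z) := by
  induction h using induction with
  | halg r => exact ⟨algebraMap k _ r, (Algebra.commutes r _).symm⟩
  | ha => exact ⟨A, ((commute_e₀ (Commute.refl A)).symm.mul_right commute_az).eq.symm⟩
  | hx =>
    refine ⟨-X, ?_⟩
    rw [mul_assoc, z_x, mul_neg, ← mul_assoc, ← x_e₀, neg_mul, mul_assoc]
  | hz => exact ⟨Z, by rw [← mul_assoc, z_e₀]⟩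
  | hadd u v hu hv =>
    obtain ⟨u', hu⟩ := hu
    obtain ⟨v', hv⟩ := hv
    exact ⟨u' + v', by rw [mul_add, add_mul, hu, hv]⟩
  | hmul u v hu hv =>
    obtain ⟨u', hu⟩ := hu
    obtain ⟨v', hv⟩ := hv
    exact ⟨u' * v', by rw [← mul_assoc, hu, mul_assoc, hv, mul_assoc]⟩

theorem e₀_mul_z_sq : E₀ * Z * (E₀ * Z) = 0 := by
  rw [mul_assoc, ← mul_assoc Z, z_e₀, mul_assoc, zz, ← mul_assoc, e₀_e₀, mul_sub, e₀_a, mul_one,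
    sub_self]

theorem e₀_mul_z_mul_e₀_mul_z (h : H8p k p i) : E₀ * Z * h * (E₀ * Z) = 0 := by
  obtain ⟨h', hh⟩ := exists_e₀_mul_z_mul h
  rw [hh, mul_assoc, e₀_mul_z_sq, mul_zero]

-- In a semisimple ring the left ideal of e₀z is generated by an idempotent h e₀z. But e₀z h e₀z = 0
-- for all h, so this idempotent vanishes, against e₀z ≠ 0.
include hψ in
theorem not_isSemisimpleRing : ¬ IsSemisimpleRing (H8p k p i) := by
  intro hs
  obtain ⟨e, he, heq⟩ := IsSemisimpleRing.ideal_eq_span_idempotent (Ideal.span {E₀ * Z})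
  have h1 : e ∈ Ideal.span {E₀ * Z} := by rw [heq]; exact Ideal.mem_span_singleton_self e
  obtain ⟨h, rfl⟩ := Ideal.mem_span_singleton'.1 h1
  have h2 : h * (E₀ * Z) = 0 := by
    rw [← he.eq, mul_assoc, ← mul_assoc _ h, e₀_mul_z_mul_e₀_mul_z, mul_zero]
  rw [h2, Ideal.span_singleton_eq_bot.2 rfl, Ideal.span_singleton_eq_bot] at heq
  exact e₀_mul_z_ne_zero hψ heq

/-! ### The matrix blocks where a acts by -1 -/

/-- Preimages of the matrix units under `dicRep (xa j)`. -/
def matUnit (i : {c : k // c ^ 2 = -1}) (ψ : AddChar (ZMod (2 * p)) k) (j : ZMod (2 * p)) :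
    Fin 2 → Fin 2 → H8p k p i :=
  ![![idem i ψ (.xa j), (-2⁻¹ : k) • (idem i ψ (.xa j) * z k p i)],
    ![idem i ψ (.xa (j + p)) * z k p i, idem i ψ (.xa (j + p))]]

theorem add_p_add_p (j : ZMod (2 * p)) : j + p + p = j := by
  rw [add_assoc, natCast_add_natCast_self, add_zero]

theorem add_p_ne (j : ZMod (2 * p)) : j + p ≠ j := by
  rw [Ne, add_eq_left]; exact natCast_ne_zero

theorem dicRep_xa_z (j : ZMod (2 * p)) : dicRep i hψ (.xa j) Z = !![0, -2; 1, 0] := by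
  rw [dicRep, rep_z]; norm_num

theorem dicRep_matUnit (j : ZMod (2 * p)) (l m : Fin 2) :
    dicRep i hψ (.xa j) (matUnit i ψ j l m) = Matrix.single l m 1 := by
  have h1 := add_p_ne j
  have h2 := h1.symm
  ext a b
  fin_cases l <;> fin_cases m <;> fin_cases a <;> fin_cases b <;>
    simp [matUnit, dicRep_idem, dicRep_idem_mul_z, dicRep_xa_z, h1, h2]

/-- The block of j involves only the labels j and j + p. Its matrix units therefore vanish in every
block whose two labels differ from these, which separates the blocks in the dual. -/
theorem dicRep_matUnit_of_ne {j j' : ZMod (2 * p)} (h : j' ≠ j) (h' : j' + p ≠ j) (l m : Fin 2) :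
    dicRep i hψ (.xa j') (matUnit i ψ j l m) = 0 := by
  have h1 : j' ≠ j + p := fun h1 => h' (by rw [h1, add_p_add_p])
  ext a b
  fin_cases l <;> fin_cases m <;> fin_cases a <;> fin_cases b <;>
    simp [matUnit, dicRep_idem, dicRep_idem_mul_z, h, h', h1]

theorem dicRep_surjective (j : ZMod (2 * p)) : Function.Surjective (dicRep i hψ (.xa j)) := by
  intro M
  refine ⟨∑ l, ∑ m, M l m • matUnit i ψ j l m, ?_⟩
  simp only [map_sum, map_smul, dicRep_matUnit]
  conv_rhs => rw [Matrix.matrix_eq_sum_single M]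
  simp [Matrix.smul_single]

-- Pulling k² back along a surjection onto its full endomorphism algebra keeps it simple, and its
-- dimension is 2.
include hψ in
theorem not_isBasicAlgebra : ¬ IsBasicAlgebra k (H8p k p i) := by
  intro h
  let f : H8p k p i →ₐ[k] Module.End k (Fin 2 → k) :=
    (Matrix.toLinAlgEquiv' (R := k) (n := Fin 2)).toAlgHom.comp (dicRep i hψ (.xa 0))
  have hf : Function.Surjective f :=
    (Matrix.toLinAlgEquiv' (R := k) (n := Fin 2)).surjective.comp (dicRep_surjective hψ 0)
  let : Module (H8p k p i) (Fin 2 → k) := Module.compHom _ f.toRingHom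
  have : IsScalarTower k (H8p k p i) (Fin 2 → k) := ⟨fun r h v => by
    change f (r • h) v = r • f h v
    rw [map_smul]; rfl⟩
  have hs : IsSimpleModule (H8p k p i) (Fin 2 → k) := by
    rw [isSimpleModule_iff_toSpanSingleton_surjective]
    refine ⟨inferInstance, fun v hv w => ?_⟩
    obtain ⟨T, hT⟩ : ∃ T : Module.End k (Fin 2 → k), T v = w :=
      (isSimpleModule_iff_toSpanSingleton_surjective.1
        (inferInstance : IsSimpleModule (Module.End k (Fin 2 → k)) _)).2 v hv w
    obtain ⟨u, rfl⟩ := hf T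
    exact ⟨u, hT⟩
  have := h _ hs
  simp at this

/-! ### The function algebra of the dicyclic group inside H -/

section FunctionHopf

include hψ in
theorem counitHom_idem (q : QuaternionGroup p) :
    counitHom k p i (idem i ψ q) = if q = 1 then 1 else 0 := by
  rcases q with j | j
  · have h := hψ.sum_smul_sum_smul (fun _ : Unit => 0) (fun _ => (1 : k)) j
    simp only [smul_eq_mul, Finset.univ_unique, Finset.sum_singleton, mul_one,
      zero_mul, AddChar.map_zero_eq_one] at h
    simp only [QuaternionGroup.one_def, QuaternionGroup.a.injEq, eq_comm (b := (0 : ZMod (2 * p)))]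
    rw [← h, idem, xIdem, map_mul, counitHom_e₀, one_mul, map_smul, map_sum, smul_eq_mul]
    simp [xpow, counitHom_x]
  · rw [if_neg (by rintro ⟨⟩), idem, map_mul, counitHom_e₁, zero_mul]

variable (i ψ) in
/-- The isomorphism of the function algebra of the dicyclic group with the subalgebra generated by
`a` and `x`, as a linear map to `H_{8p}`. -/
def functionMap : FunctionHopf k (QuaternionGroup p) →ₗ[k] H8p k p i where
  toFun f := ∑ q, f (MonoidAlgebra.single q 1) • idem i ψ q
  map_add' f g := by simp [add_smul, Finset.sum_add_distrib]
  map_smul' c f := by simp [mul_smul, Finset.smul_sum]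

theorem functionMap_apply (f : FunctionHopf k (QuaternionGroup p)) :
    functionMap i ψ f = ∑ q, f (MonoidAlgebra.single q 1) • idem i ψ q := rfl

/-- The Hopf algebra map from the function algebra of the dicyclic group to `H_{8p}`. -/
def functionHom (i : {c : k // c ^ 2 = -1}) (hψ : ψ.IsPrimitive) :
    FunctionHopf k (QuaternionGroup p) →ₐc[k] H8p k p i :=
  BialgHom.ofAlgHom
    (AlgHom.ofLinearMap (functionMap i ψ)
      (by simp [functionMap_apply, sum_idem hψ])
      (by
        intro f f'
        simp only [functionMap_apply, Finset.sum_mul_sum, smul_mul_smul_comm, idem_mul_idem hψ,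
          smul_ite, smul_zero, Finset.sum_ite_eq, Finset.mem_univ, if_true, LinDual.mul_apply]
        simp))
    (by
      ext f
      change counitHom k p i (functionMap i ψ f) = f 1
      simp [functionMap_apply, counitHom_idem hψ, MonoidAlgebra.one_def])
    (by
      have key : ∀ t : FunctionHopf k (QuaternionGroup p) ⊗[k] FunctionHopf k (QuaternionGroup p),
          TensorProduct.map (functionMap i ψ) (functionMap i ψ) t = ∑ q, ∑ r,
            LinDual.pairing k _ t (MonoidAlgebra.single q 1 ⊗ₜ MonoidAlgebra.single r 1) •
              idem i ψ q ⊗ₜ[k] idem i ψ r := by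
        intro t
        induction t with
        | zero => simp
        | add s t hs ht => simp [hs, ht, add_smul, Finset.sum_add_distrib]
        | tmul f g =>
          simp only [TensorProduct.map_tmul, functionMap_apply, TensorProduct.sum_tmul,
            TensorProduct.tmul_sum, TensorProduct.smul_tmul_smul, LinDual.pairing_tmul]
          exact Finset.sum_comm
      ext f
      refine (key _).trans ?_
      change _ = comul (R := k) (functionMap i ψ f)
      simp only [functionMap_apply, map_sum, map_smul, comul_idem hψ, Finset.smul_sum]
      conv_rhs => rw [Finset.sum_comm]
      refine Finset.sum_congr rfl fun q _ => ?_
      -- Substituting t = q r turns the coefficient f(t) into f(q r), which is the pairing of Δ(f)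
      -- with q ⊗ r.
      rw [← Equiv.sum_comp (Equiv.mulLeft q) fun t =>
        f (MonoidAlgebra.single t 1) • idem i ψ q ⊗ₜ[k] idem i ψ (q⁻¹ * t)]
      refine Finset.sum_congr rfl fun r _ => ?_
      have h := LinDual.pairing_comul f (MonoidAlgebra.single q 1) (MonoidAlgebra.single r 1)
      rw [MonoidAlgebra.single_mul_single, one_mul] at h
      rw [Equiv.coe_mulLeft, inv_mul_cancel_left, ← h]
      rfl)

theorem functionHom_apply (f : FunctionHopf k (QuaternionGroup p)) :
    functionHom i hψ f = ∑ q, f (MonoidAlgebra.single q 1) • idem i ψ q := rfl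

theorem range_functionHom : LinearMap.range (functionHom i hψ :
    FunctionHopf k (QuaternionGroup p) →ₗ[k] H8p k p i) = idemSpan i ψ := by
  apply le_antisymm
  · rintro _ ⟨f, rfl⟩
    exact Submodule.sum_mem _ fun q _ => Submodule.smul_mem _ _ (idem_mem q)
  · refine Submodule.span_le.2 ?_
    rintro _ ⟨q, rfl⟩
    refine ⟨(LinDual.toDual k _).symm ((Finsupp.lapply q).comp
      (MonoidAlgebra.coeffLinearEquiv k).toLinearMap), ?_⟩
    refine (functionHom_apply hψ _).trans ?_
    simp [Finsupp.single_apply]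

theorem functionHom_injective : Function.Injective (functionHom i hψ) := by
  rw [injective_iff_map_eq_zero]
  intro f hf
  have h : ∀ q, f (MonoidAlgebra.single q 1) = 0 := by
    intro q
    have := congrArg (coord i hψ (q, 0)) hf
    simpa [functionHom_apply, coord_idem] using this
  ext w
  induction w using MonoidAlgebra.induction_on with
  | of q => exact h q
  | add u v hu hv => rw [map_add, hu, hv, map_add]
  | smul r u hu => rw [map_smul, hu, map_smul]

/-- Both sides are the span of the idempotents: the Fourier transform writes these in terms of a and
x, and Fourier inversion writes a and x in terms of them. -/
theorem algHom_range_functionHom :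
    (functionHom i hψ : FunctionHopf k (QuaternionGroup p) →ₐ[k] H8p k p i).range =
      Algebra.adjoin k {A, X} := by
  have hr : ∀ w, w ∈ (functionHom i hψ : FunctionHopf k (QuaternionGroup p) →ₐ[k] _).range ↔
      w ∈ idemSpan i ψ := fun w => by rw [← range_functionHom hψ]; rfl
  have ha : A ∈ Algebra.adjoin k {A, X} := Algebra.subset_adjoin (by simp)
  have hx : X ∈ Algebra.adjoin k {A, X} := Algebra.subset_adjoin (by simp)
  apply le_antisymm
  · intro w hw
    rw [hr] at hw
    have hw' : idemSpan i ψ ≤ Subalgebra.toSubmodule (Algebra.adjoin k {A, X}) := by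
      refine Submodule.span_le.2 ?_
      rintro _ ⟨q | q, rfl⟩
      · rw [idem_a_eq]
        exact Subalgebra.smul_mem _ (Subalgebra.sum_mem _ fun m _ => Subalgebra.smul_mem _
          (MulMemClass.mul_mem (Subalgebra.smul_mem _ (add_mem (one_mem _) ha) _) (pow_mem hx _)) _) _
      · rw [idem_xa_eq]
        exact Subalgebra.smul_mem _ (Subalgebra.sum_mem _ fun m _ => Subalgebra.smul_mem _
          (MulMemClass.mul_mem (Subalgebra.smul_mem _ (sub_mem (one_mem _) ha) _) (pow_mem hx _)) _) _
    exact hw' hw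
  · refine Algebra.adjoin_le ?_
    rintro w (rfl | rfl)
    · rw [SetLike.mem_coe, hr, a_eq_sum_idem hψ]
      exact Submodule.sub_mem _ (Submodule.sum_mem _ fun _ _ => idem_mem _)
        (Submodule.sum_mem _ fun _ _ => idem_mem _)
    · rw [SetLike.mem_coe, hr, ← xpow_one, ← one_mul (xpow k p i 1), ← e₀_add_e₁, add_mul]
      exact Submodule.add_mem _ (e₀_mul_xpow_mem hψ 1) (e₁_mul_xpow_mem hψ 1)

end FunctionHopf

/-! ### The coradical of the dual Hopf algebra -/

variable (i) in
/-- The one-dimensional representations `a ↦ 1`, `x ↦ ψ m`, `z ↦ 0` of `H_{8p}`. -/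
def charHom (ψ : AddChar (ZMod (2 * p)) k) (m : ZMod (2 * p)) : H8p k p i →ₐ[k] k :=
  lift i 1 (ψ m) 0 (by simp)
    (by rw [← AddChar.map_nsmul_eq_pow, nsmul_eq_mul, ZMod.natCast_self, zero_mul,
      AddChar.map_zero_eq_one])
    (by simp) (by simp) (by simp) (by simp)

theorem charHom_a (m : ZMod (2 * p)) : charHom i ψ m A = 1 := by simp [charHom]
theorem charHom_x (m : ZMod (2 * p)) : charHom i ψ m X = ψ m := by simp [charHom]
theorem charHom_z (m : ZMod (2 * p)) : charHom i ψ m Z = 0 := by simp [charHom]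

theorem charHom_xpow (m n : ZMod (2 * p)) : charHom i ψ m (xpow k p i n) = ψ (m * n) := by
  rw [xpow, map_pow, charHom_x, ← AddChar.map_nsmul_eq_pow, nsmul_eq_mul, ZMod.natCast_zmod_val,
    mul_comm n]

theorem charHom_e₀ (m : ZMod (2 * p)) : charHom i ψ m E₀ = 1 := by
  rw [e₀, map_smul, map_add, map_one, charHom_a, one_add_one_eq_two, smul_eq_mul,
    inv_mul_cancel₀ two_ne_zero]

theorem charHom_e₁ (m : ZMod (2 * p)) : charHom i ψ m E₁ = 0 := by simp [e₁, charHom_a]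

include hψ in
theorem charHom_idem_a (m j : ZMod (2 * p)) :
    charHom i ψ m (idem i ψ (.a j)) = if m = j then 1 else 0 := by
  have h := hψ.sum_smul_sum_smul (fun _ : Unit => m) (fun _ => (1 : k)) j
  simp only [smul_eq_mul, Finset.univ_unique, Finset.sum_singleton, mul_one] at h
  rw [idem, map_mul, charHom_e₀, one_mul, xIdem, map_smul, map_sum, ← h]
  simp [charHom_xpow]

/-- The algebra maps `charHom m` as elements of the dual Hopf algebra. -/
def charElem (i : {c : k // c ^ 2 = -1}) (ψ : AddChar (ZMod (2 * p)) k) :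
    Multiplicative (ZMod (2 * p)) →* LinDual k (H8p k p i) where
  toFun m := (LinDual.toDual k _).symm (charHom i ψ m.toAdd).toLinearMap
  map_one' := by
    have h : charHom i ψ 0 = counitHom k p i := by
      apply hom_ext <;>
      simp [charHom_a, charHom_x, charHom_z, counitHom_a, counitHom_x, counitHom_z]
    ext w
    change charHom i ψ 0 w = counitHom k p i w
    rw [h]
  map_mul' m n := by
    -- These characters kill e₁, so only x ⊗ e₀x contributes to the value on Δ(x), and it gives
    -- ψ(m)ψ(n).
    have h : charHom i ψ (m.toAdd + n.toAdd) = (Algebra.TensorProduct.lmul' k).comp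
        ((Algebra.TensorProduct.map (charHom i ψ m.toAdd) (charHom i ψ n.toAdd)).comp
          (comulHom k p i)) := by
      apply hom_ext <;>
      simp [charHom_a, charHom_x, charHom_z, comulHom_a, comulHom_x, comulHom_z, charHom_e₀,
        charHom_e₁, AddChar.map_add_eq_mul]
    ext w
    change charHom i ψ (m.toAdd + n.toAdd) w = _
    rw [h]
    rfl

theorem charElem_apply (m : Multiplicative (ZMod (2 * p))) (w : H8p k p i) :
    charElem i ψ m w = charHom i ψ m.toAdd w := rfl

theorem isGroupLikeElem_charElem (m : Multiplicative (ZMod (2 * p))) :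
    IsGroupLikeElem k (charElem i ψ m) :=
  LinDual.isGroupLikeElem_of_algHom _

/-- The Hopf algebra map from the group algebra of the cyclic group to the dual of `H_{8p}`. -/
def cyclicHom (i : {c : k // c ^ 2 = -1}) (ψ : AddChar (ZMod (2 * p)) k) :
    MonoidAlgebra k (Multiplicative (ZMod (2 * p))) →ₐc[k] LinDual k (H8p k p i) :=
  BialgHom.ofAlgHom (MonoidAlgebra.lift k _ _ (charElem i ψ))
    (by
      ext m
      simp [(isGroupLikeElem_charElem m).counit_eq_one])
    (by
      ext m
      simp [(isGroupLikeElem_charElem m).comul_eq_tmul_self])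

theorem cyclicHom_of (m : Multiplicative (ZMod (2 * p))) :
    cyclicHom i ψ (MonoidAlgebra.of k _ m) = charElem i ψ m :=
  MonoidAlgebra.lift_of _ _

/-- The sum of `cyclicHom` and the coalgebra maps dual to the representations
`dicRep (xa j)`. -/
def dualHom (i : {c : k // c ^ 2 = -1}) (hψ : ψ.IsPrimitive) :
    (MonoidAlgebra k (Multiplicative (ZMod (2 * p))) × (Fin p → MatrixCoalgebra k 2)) →ₗc[k]
      LinDual k (H8p k p i) :=
  CoalgHom.prodPiDesc (cyclicHom i ψ : _ →ₗc[k] _)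
    fun j : Fin p => LinDual.coalgMap (dicRep i hψ (.xa (j : ℕ)))

theorem dualHom_apply (c : MonoidAlgebra k (Multiplicative (ZMod (2 * p))))
    (M : Fin p → MatrixCoalgebra k 2) : dualHom i hψ (c, M) =
      cyclicHom i ψ c + ∑ j : Fin p, LinDual.coalgMap (dicRep i hψ (.xa (j : ℕ))) (M j) :=
  CoalgHom.prodPiDesc_apply _ _ _

theorem dualHom_apply_apply (c : MonoidAlgebra k (Multiplicative (ZMod (2 * p))))
    (M : Fin p → MatrixCoalgebra k 2) (w : H8p k p i) : dualHom i hψ (c, M) w =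
      cyclicHom i ψ c w + ∑ j : Fin p, M j (dicRep i hψ (.xa (j : ℕ)) w) := by
  rw [dualHom_apply, LinDual.add_apply]
  congr 1
  exact LinearMap.sum_apply _ _ _

include hψ in
theorem cyclicHom_idem_a (c : MonoidAlgebra k (Multiplicative (ZMod (2 * p)))) (j : ZMod (2 * p)) :
    cyclicHom i ψ c (idem i ψ (.a j)) = c.coeff (.ofAdd j) := by
  induction c using MonoidAlgebra.induction_on with
  | of m =>
    rw [cyclicHom_of, charElem_apply, charHom_idem_a hψ, MonoidAlgebra.of_apply]
    simp [Finsupp.single_apply]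
    rfl
  | add u v hu hv => simp [hu, hv]
  | smul r u hu => simp [hu]

/-- The numbers below p represent the classes of ℤ/2p modulo p. Since the block of j carries the
labels j and j + p, these representatives give p blocks without overlap. -/
theorem natCast_fin_injective {j j' : Fin p} (h : j' ≠ j) :
    ((j' : ℕ) : ZMod (2 * p)) ≠ (j : ℕ) ∧ ((j' : ℕ) : ZMod (2 * p)) + p ≠ (j : ℕ) := by
  have h1 := j.2
  have h2 := j'.2
  constructor
  · rw [Ne, ZMod.natCast_eq_natCast_iff', Nat.mod_eq_of_lt (by omega), Nat.mod_eq_of_lt (by omega)]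
    exact fun h3 => h (Fin.ext h3)
  · rw [← Nat.cast_add, Ne, ZMod.natCast_eq_natCast_iff', Nat.mod_eq_of_lt (by omega),
      Nat.mod_eq_of_lt (by omega)]
    omega

/-- The idempotents e₀ξ_j, with ξ_j = `xIdem i ψ j`, vanish in all matrix blocks and read off the
coefficients of the group algebra part. Once this part is zero, the preimages of the matrix units of
one block, which vanish in the others, read off each matrix functional. -/
theorem dualHom_injective : Function.Injective (dualHom i hψ) := by
  rw [injective_iff_map_eq_zero]
  rintro ⟨c, M⟩ h
  have hw : ∀ w, cyclicHom i ψ c w + ∑ j : Fin p, M j (dicRep i hψ (.xa (j : ℕ)) w) = 0 := by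
    intro w
    rw [← dualHom_apply_apply, h, LinDual.zero_apply]
  have hc : c = 0 := by
    ext m
    have h1 := hw (idem i ψ (.a m.toAdd))
    have h0 : (Matrix.diagonal ![0, 0] : Matrix (Fin 2) (Fin 2) k) = 0 := by
      ext a b
      fin_cases a <;> fin_cases b <;> simp
    rw [cyclicHom_idem_a hψ] at h1
    simpa [dicRep_idem, h0] using h1
  subst hc
  have hM : M = 0 := by
    funext j
    ext B
    have h1 : ∀ l m, M j (Matrix.single l m 1) = 0 := by
      intro l m
      have h1 := hw (matUnit i ψ (j : ℕ) l m)
      rw [map_zero, LinDual.zero_apply, zero_add, Finset.sum_eq_single j, dicRep_matUnit] at h1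
      · exact h1
      · intro j' _ hj
        rw [dicRep_matUnit_of_ne hψ (natCast_fin_injective hj).1 (natCast_fin_injective hj).2,
          map_zero]
      · simp
    rw [LinDual.apply_eq_sum]
    simp [h1]
  rw [hM]
  rfl

variable (k p i) in
/-- The functionals on `H_{8p}` vanishing on its radical, the ideal generated by `e₀ z`. -/
def radicalPerp : Submodule k (LinDual k (H8p k p i)) where
  carrier := {f | ∀ h, f (h * (E₀ * Z)) = 0}
  add_mem' hf hg h := by rw [LinDual.add_apply, hf, hg, add_zero]
  zero_mem' _ := rfl
  smul_mem' c f hf h := by rw [LinDual.smul_apply, hf, mul_zero]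

theorem coradical_linDual_le : coradical k (LinDual k (H8p k p i)) ≤ radicalPerp k p i :=
  LinDual.coradical_le_of_normal exists_e₀_mul_z_mul e₀_mul_z_sq fun _ => Iff.rfl

theorem range_dualHom_le : LinearMap.range (dualHom i hψ :
    (MonoidAlgebra k (Multiplicative (ZMod (2 * p))) × (Fin p → MatrixCoalgebra k 2)) →ₗ[k]
      LinDual k (H8p k p i)) ≤ coradical k (LinDual k (H8p k p i)) := by
  rintro _ ⟨⟨c, M⟩, rfl⟩
  refine (dualHom_apply hψ c M).symm ▸ Submodule.add_mem _ ?_ (Submodule.sum_mem _ fun j _ => ?_)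
  · induction c using MonoidAlgebra.induction_on with
    | of m =>
      rw [cyclicHom_of]
      exact (isSimpleSubcoalgebra_of_isGroupLikeElem (isGroupLikeElem_charElem m)).le_coradical
        (Submodule.mem_span_singleton_self _)
    | add u v hu hv => rw [map_add]; exact Submodule.add_mem _ hu hv
    | smul r u hu => rw [map_smul]; exact Submodule.smul_mem _ _ hu
  · exact LinDual.coalgMap_mem_coradical _ _ (dicRep_matUnit hψ _) _

-- In the basis of idempotents and their products with z, the 2p elements e₀ξ_j z, with ξ_j = `xIdem
-- i ψ j`, lie in the ideal of e₀z. A functional vanishing there is determined by its values on the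
-- other 4p + 2p basis elements.
include hψ in
theorem finrank_radicalPerp_le : Module.finrank k (radicalPerp k p i) ≤ 6 * p := by
  let F : radicalPerp k p i →ₗ[k] (QuaternionGroup p → k) × (ZMod (2 * p) → k) :=
    { toFun := fun f => (fun q => f.1 (idem i ψ q), fun j => f.1 (idem i ψ (.xa j) * Z))
      map_add' := fun _ _ => rfl
      map_smul' := fun _ _ => rfl }
  have hF : Function.Injective F := by
    rw [injective_iff_map_eq_zero]
    rintro ⟨f, hf⟩ h
    have h1 : ∀ q, f (idem i ψ q) = 0 := fun q => congrFun (congrArg Prod.fst h) q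
    have h2 : ∀ j, f (idem i ψ (.xa j) * Z) = 0 := fun j => congrFun (congrArg Prod.snd h) j
    have h3 : ∀ j, f (idem i ψ (.a j) * Z) = 0 := fun j => by
      rw [idem, (commute_e₀ (commute_a_xIdem j)).eq, mul_assoc]
      exact hf _
    have h4 : LinDual.toDual k _ f = 0 := by
      refine (basis i hψ).ext ?_
      rintro ⟨q, l⟩
      match l, q with
      | 0, q => rw [basis_zero]; exact h1 q
      | 1, .a j => rw [basis_one]; exact h3 j
      | 1, .xa j => rw [basis_one]; exact h2 j
    exact Subtype.ext ((LinDual.toDual k _).map_eq_zero_iff.1 h4)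
  refine (LinearMap.finrank_le_finrank_of_injective hF).trans ?_
  rw [Module.finrank_prod, Module.finrank_fintype_fun_eq_card, Module.finrank_fintype_fun_eq_card,
    QuaternionGroup.card, ZMod.card]
  omega

/-- The range lies in the coradical, which lies in the space of functionals vanishing on the ideal
of e₀z. By injectivity the range has dimension 2p + 4p, the upper bound for that space, so both
inclusions are equalities. -/
theorem range_dualHom : LinearMap.range (dualHom i hψ :
    (MonoidAlgebra k (Multiplicative (ZMod (2 * p))) × (Fin p → MatrixCoalgebra k 2)) →ₗ[k]
      LinDual k (H8p k p i)) = coradical k (LinDual k (H8p k p i)) := by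
  have : Module.Finite k (LinDual k (H8p k p i)) :=
    Module.Finite.equiv (LinDual.toDual k (H8p k p i)).symm
  have : Module.Finite k (MatrixCoalgebra k 2) :=
    Module.Finite.equiv (LinDual.toDual k (Matrix (Fin 2) (Fin 2) k)).symm
  have h2 : Module.finrank k (MatrixCoalgebra k 2) = 4 := by
    rw [(LinDual.toDual k (Matrix (Fin 2) (Fin 2) k)).finrank_eq, Subspace.dual_finrank_eq,
      Module.finrank_matrix]
    simp
  have h : LinearMap.range (dualHom i hψ : (MonoidAlgebra k (Multiplicative (ZMod (2 * p))) ×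
      (Fin p → MatrixCoalgebra k 2)) →ₗ[k] LinDual k (H8p k p i)) = radicalPerp k p i := by
    refine Submodule.eq_of_le_of_finrank_le
      ((range_dualHom_le hψ).trans coradical_linDual_le) ?_
    rw [LinearMap.finrank_range_of_inj (f := (dualHom i hψ :
      (MonoidAlgebra k (Multiplicative (ZMod (2 * p))) × (Fin p → MatrixCoalgebra k 2)) →ₗ[k]
        LinDual k (H8p k p i))) (dualHom_injective hψ), Module.finrank_prod,
      Module.finrank_pi_fintype, h2,
      Module.finrank_eq_card_basis (MonoidAlgebra.basis (Multiplicative (ZMod (2 * p))) k)]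
    refine (finrank_radicalPerp_le hψ).trans ?_
    simp
    omega
  exact le_antisymm (range_dualHom_le hψ) (h ▸ coradical_linDual_le)

end Odd
end H8p

end

theorem mainTheorem7 {k : Type*} [Field k] [IsAlgClosed k] [CharZero k]
    (p : ℕ) [Fact p.Prime] [Fact (Odd p)] (i : {c : k // c ^ 2 = -1}) :
    ¬ IsSemisimpleRing (H8p k p i) ∧
    ¬ IsPointedCoalgebra k (H8p k p i) ∧
    ¬ IsBasicAlgebra k (H8p k p i) ∧
    Module.finrank k (H8p k p i) = 8 * p ∧
    (∃ φ : FunctionHopf k (QuaternionGroup p) →ₐc[k] H8p k p i,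
      Function.Injective φ ∧
      (φ : FunctionHopf k (QuaternionGroup p) →ₐ[k] H8p k p i).range =
        Algebra.adjoin k {H8p.a k p i, H8p.x k p i} ∧
      LinearMap.range (φ : FunctionHopf k (QuaternionGroup p) →ₗ[k] H8p k p i) =
        coradical k (H8p k p i)) ∧
    (∃ (Θ : (MonoidAlgebra k (Multiplicative (ZMod (2 * p))) × (Fin p → MatrixCoalgebra k 2)) →ₗc[k]
          LinDual k (H8p k p i))
        (φ : MonoidAlgebra k (Multiplicative (ZMod (2 * p))) →ₐc[k] LinDual k (H8p k p i)),
      Function.Injective Θ ∧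
      LinearMap.range (Θ : (MonoidAlgebra k (Multiplicative (ZMod (2 * p))) ×
        (Fin p → MatrixCoalgebra k 2)) →ₗ[k] LinDual k (H8p k p i)) =
        coradical k (LinDual k (H8p k p i)) ∧
      ∀ c, Θ (c, 0) = φ c) := by
  have : NeZero ((2 * p : ℕ) : k) := H8p.neZero_two_mul
  -- An algebraically closed field of characteristic zero has a primitive 2p-th root of unity, and
  -- this is the same as a primitive character of ℤ/2p.
  obtain ⟨ζ, hζ⟩ := HasEnoughRootsOfUnity.exists_primitiveRoot k (2 * p)
  obtain ⟨ψ, hψ⟩ : ∃ ψ : AddChar (ZMod (2 * p)) k, ψ.IsPrimitive :=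
    ⟨_, AddChar.zmodChar_primitive_of_primitive_root (2 * p) hζ⟩
  exact ⟨H8p.not_isSemisimpleRing hψ, H8p.not_isPointedCoalgebra hψ (Nat.Prime.one_lt Fact.out).ne',
    H8p.not_isBasicAlgebra hψ, H8p.finrank_eq hψ,
    ⟨H8p.functionHom i hψ, H8p.functionHom_injective hψ, H8p.algHom_range_functionHom hψ,
      (H8p.range_functionHom hψ).trans (H8p.coradical_eq hψ).symm⟩,
    H8p.dualHom i hψ, H8p.cyclicHom i ψ, H8p.dualHom_injective hψ, H8p.range_dualHom hψ,
    fun c => by rw [H8p.dualHom_apply]; simp⟩
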